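/- Let $\sigma\in S_n$ be a permutation of $\{1,\dots,n\}$ and let $k\ge 1$ be an integer. A subsequence of positions $1\le i_1<i_2<\dots<i_t\le n$ is called $k$-alternating for $\sigma$ if \[ \sigma(i_1)\ge \sigma(i_2)+k,\qquad \sigma(i_2)+k\le \sigma(i_3),\qquad \sigma(i_3)\ge \sigma(i_4)+k,\ \dots \] (up to $i_t$). Let $\operatorname{as}_{n,k}(\sigma)$ be the largest length $t$ of a $k$-alternating subsequence for $\sigma$, and regard $\operatorname{as}_{n,k}$ as a random variable by taking $\sigma$ uniformly at random in $S_n$. **Theorem.** Let $k$ be a fixed positive integer. Then, as $n\to\infty$, \[ \frac{\operatorname{as}_{n,k}-\mathbb{E}[\operatorname{as}_{n,k}]}{\sqrt{\operatorname{Var}(\operatorname{as}_{n,k})}}\longrightarrow_d \mathcal{G}, \] where $\mathcal{G}$ has the standard normal distribution and $\longrightarrow_d$ denotes convergence in distribution. (For the finitely many $n$ with $\operatorname{Var}(\operatorname{as}_{n,k})=0$ the quotient is read as $0$.) -/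

import Mathlib

open MeasureTheory ProbabilityTheory Filter

/-- The positions `i 0, i 1, …, i (t - 1)` form a `k`-alternating subsequence of the permutation
`σ` of `{0, …, n - 1}`: they are strictly increasing and
`σ (i 0) ≥ σ (i 1) + k`, `σ (i 1) + k ≤ σ (i 2)`, `σ (i 2) ≥ σ (i 3) + k`, and so on.
(Positions and values are numbered from `0`; only order and differences matter.) -/
def IsKAlternating {n : ℕ} (k : ℕ) (σ : Equiv.Perm (Fin n)) {t : ℕ} (i : Fin t → Fin n) : Prop :=
  StrictMono i ∧
    ∀ (j : ℕ) (hj : j + 1 < t),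
      if Even j then
        (σ (i ⟨j + 1, hj⟩) : ℕ) + k ≤ (σ (i ⟨j, Nat.lt_of_succ_lt hj⟩) : ℕ)
      else
        (σ (i ⟨j, Nat.lt_of_succ_lt hj⟩) : ℕ) + k ≤ (σ (i ⟨j + 1, hj⟩) : ℕ)

/-- The length of the longest `k`-alternating subsequence of `σ`. -/
noncomputable def longestKAlternating {n : ℕ} (k : ℕ) (σ : Equiv.Perm (Fin n)) : ℕ :=
  sSup {t : ℕ | ∃ i : Fin t → Fin n, IsKAlternating k σ i}

/-- The supremum in the definition of `longestKAlternating` is a maximum. -/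
theorem longestKAlternating_isGreatest {n : ℕ} (k : ℕ) (σ : Equiv.Perm (Fin n)) :
    IsGreatest {t : ℕ | ∃ i : Fin t → Fin n, IsKAlternating k σ i} (longestKAlternating k σ) := by
  have hbdd : BddAbove {t : ℕ | ∃ i : Fin t → Fin n, IsKAlternating k σ i} := by
    refine ⟨n, ?_⟩
    rintro t ⟨i, hi, -⟩
    simpa using Fintype.card_le_of_injective i hi.injective
  have hne : {t : ℕ | ∃ i : Fin t → Fin n, IsKAlternating k σ i}.Nonempty :=
    ⟨0, Fin.elim0, fun a => a.elim0, fun j hj => absurd hj (Nat.not_lt_zero _)⟩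
  exact ⟨Nat.sSup_mem hne hbdd, fun t ht => le_csSup hbdd ht⟩

/-- Every set of permutations of `Fin n` is an event. -/
instance permFinMeasurableSpace (n : ℕ) : MeasurableSpace (Equiv.Perm (Fin n)) := ⊤

instance permFinDiscreteMeasurableSpace (n : ℕ) :
    DiscreteMeasurableSpace (Equiv.Perm (Fin n)) := ⟨fun _ => trivial⟩

/-- The uniform distribution on the permutations of `n` letters. -/
noncomputable def uniformPerm (n : ℕ) : Measure (Equiv.Perm (Fin n)) :=
  uniformOn Set.univ

instance uniformPerm_isProbabilityMeasure (n : ℕ) : IsProbabilityMeasure (uniformPerm n) :=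
  isProbabilityMeasure_uniformOn Set.finite_univ Set.univ_nonempty

/-- `as_{n,k}` as a real random variable on the permutations of `n` letters. -/
noncomputable def asRV (n k : ℕ) (σ : Equiv.Perm (Fin n)) : ℝ :=
  (longestKAlternating k σ : ℝ)

/-! For `k = 1` the longest alternating subsequence is found greedily, and its length is, up to a
bounded error, the number of interior local extrema. For general `k` the greedy construction loses
at most two terms at each step whose height is less than `k`
(`abs_longestKAlternating_sub_sum_turn_le`). In a random permutation an adjacent pair is that close
with probability `O(k/n)`, so the number of small steps has bounded second moment
(`integral_smallSteps_sq_le`), which is negligible against fluctuations of order `√n`.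

It remains to prove a central limit theorem for the number of local extrema. This depends only on
relative order, so the permutation may be replaced by an i.i.d. sequence with atomless law
(`identDistrib_orderInvariant`). There the extremum indicators are functions of three consecutive
coordinates, hence independent at distance three or more, with mean `2/3` and limiting variance
`8/45` per term. Long blocks separated by gaps of length two are i.i.d., so the classical theorem
applies to them; gaps and remainder vanish as the block length grows
(`tendsto_charFun_sum_centredTurn`).

Finally `tendsto_charFun_standardize` shows that a perturbation of bounded second moment changes
neither the variance to leading order nor the limit law. -/

/-! ### Alternating subsequences and the greedy algorithm -/

/-- The positions `g 0, …, g (t - 1)` form a `k`-alternating subsequence of the sequence `x`. -/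
def AltSeq (k : ℕ) (x : ℕ → ℕ) (t : ℕ) (g : ℕ → ℕ) : Prop :=
  ∀ j, j + 1 < t → g j < g (j + 1) ∧
    if Even j then x (g (j + 1)) + k ≤ x (g j) else x (g j) + k ≤ x (g (j + 1))

/-- The length of the longest alternating subsequence of `x 0, …, x m`, computed greedily. -/
def greedyLength (x : ℕ → ℕ) : ℕ → ℕ
  | 0 => 1
  -- An odd length means that the last term is a peak: a further ascent only moves that peak, while
  -- a descent adds a term. Even lengths are dual.
  | m + 1 => if (Odd (greedyLength x m) ↔ x m < x (m + 1)) then greedyLength x m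
      else greedyLength x m + 1

/-- The number of steps of `x` up to `m` of height less than `k`. -/
def smallSteps (k : ℕ) (x : ℕ → ℕ) (m : ℕ) : ℕ :=
  ∑ i ∈ Finset.range m, if x i < x (i + 1) + k ∧ x (i + 1) < x i + k then 1 else 0

theorem AltSeq.mono {k : ℕ} {x : ℕ → ℕ} {t s : ℕ} {g : ℕ → ℕ} (h : AltSeq k x t g) (hs : s ≤ t) :
    AltSeq k x s g := fun j hj => h j (hj.trans_le hs)

theorem AltSeq.mono_left {k l : ℕ} {x : ℕ → ℕ} {t : ℕ} {g : ℕ → ℕ} (h : AltSeq k x t g)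
    (hl : l ≤ k) : AltSeq l x t g := by
  intro j hj
  obtain ⟨h1, h2⟩ := h j hj
  refine ⟨h1, ?_⟩
  split_ifs at h2 ⊢ <;> omega

theorem AltSeq.snoc {k : ℕ} {x : ℕ → ℕ} {t : ℕ} {g : ℕ → ℕ} {q : ℕ} (h : AltSeq k x (t + 1) g)
    (hq : g t < q) (hx : if Even t then x q + k ≤ x (g t) else x (g t) + k ≤ x q) :
    AltSeq k x (t + 2) (Function.update g (t + 1) q) := by
  intro j hj
  rcases Nat.lt_or_ge j t with hjt | hjt
  · rw [Function.update_of_ne (by omega), Function.update_of_ne (by omega)]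
    exact h j (by omega)
  · obtain rfl : j = t := by omega
    rw [Function.update_of_ne (by omega), Function.update_self]
    exact ⟨hq, hx⟩

theorem AltSeq.update_last {k : ℕ} {x : ℕ → ℕ} {t : ℕ} {g : ℕ → ℕ} {q : ℕ}
    (h : AltSeq k x (t + 1) g) (hq : g t < q) (hx : if Even t then x (g t) ≤ x q else x q ≤ x (g t)) :
    AltSeq k x (t + 1) (Function.update g t q) := by
  intro j hj
  rw [Function.update_of_ne (by omega : j ≠ t)]
  rcases Nat.lt_or_ge (j + 1) t with hjt | hjt
  · rw [Function.update_of_ne (by omega)]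
    exact h j (by omega)
  · obtain rfl : t = j + 1 := by omega
    rw [Function.update_self]
    obtain ⟨h1, h2⟩ := h j hj
    refine ⟨h1.trans hq, ?_⟩
    simp only [Nat.even_add_one] at hx
    split_ifs at * <;> omega

/-- The second conjunct makes the induction work: `x m` is at least as extreme as the end of any
subsequence of maximal length, so whenever such a subsequence can be extended at `m + 1`, the greedy
one grows too. -/
theorem AltSeq.le_greedyLength {x : ℕ → ℕ} (m : ℕ) {t : ℕ} {g : ℕ → ℕ}
    (h : AltSeq 1 x (t + 1) g) (hm : g t ≤ m) :
    t + 1 ≤ greedyLength x m ∧ (t + 1 = greedyLength x m →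
      if Even t then x (g t) ≤ x m else x m ≤ x (g t)) := by
  induction m generalizing t g with
  | zero =>
    rcases t with _ | t
    · have : g 0 = 0 := by omega
      simp [greedyLength, this]
    · have := (h t (by omega)).1
      omega
  | succ m ih =>
    have key : ∀ s, t = s + 1 → g s ≤ m ∧ AltSeq 1 x (s + 1) g := by
      rintro s rfl
      have := (h s (by omega)).1
      exact ⟨by omega, h.mono (by omega)⟩
    rcases Nat.lt_or_ge (g t) (m + 1) with hlt | hge
    · obtain ⟨h1, h2⟩ := ih h (by omega)
      rw [greedyLength]
      split_ifs with hc he he <;> refine ⟨by omega, fun e => ?_⟩ <;> try omega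
      · rw [if_pos he] at h2
        have := h2 e
        rw [← e] at hc
        have := hc.1 (by rw [Nat.odd_add_one]; simpa using he)
        omega
      · rw [if_neg he] at h2
        have := h2 e
        rw [← e, Nat.odd_add_one] at hc
        have : ¬ x m < x (m + 1) := fun h => hc.2 h (by simpa using he)
        omega
    · have hgt : g t = m + 1 := by omega
      rw [hgt]
      refine ⟨?_, fun _ => by split_ifs <;> rfl⟩
      rcases t with _ | s
      · obtain ⟨h1, -⟩ := @ih 0 (fun _ => 0) (fun j hj => by omega) (by omega)
        rw [greedyLength]; split_ifs <;> omega
      · obtain ⟨hs, ha⟩ := key s rfl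
        obtain ⟨h1, h2⟩ := ih ha hs
        obtain ⟨-, h4⟩ := h s (by omega)
        rw [greedyLength]
        split_ifs with hc
        · by_contra hcon
          have e : s + 1 = greedyLength x m := by omega
          have h3 := h2 e
          rw [← e, Nat.odd_add_one, Nat.not_odd_iff_even] at hc
          rw [hgt] at h4
          by_cases hev : Even s
          · rw [if_pos hev] at h3 h4
            have := hc.1 hev
            omega
          · rw [if_neg hev] at h3 h4
            have : ¬ x m < x (m + 1) := fun h => hev (hc.2 h)
            omega
        · omega

/-- A greedily built `k`-alternating subsequence loses at most two terms at each small step. -/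
theorem exists_altSeq_of_smallSteps {k : ℕ} {x : ℕ → ℕ} (hk : 1 ≤ k)
    (m : ℕ) (hinj : ∀ i < m, x i ≠ x (i + 1)) :
    ∃ t g, AltSeq k x t g ∧ (Even t ↔ Even (greedyLength x m)) ∧
      greedyLength x m ≤ t + 2 * smallSteps k x m ∧
      ∀ s, t = s + 1 → g s ≤ m ∧ if Even s then x m ≤ x (g s) else x (g s) ≤ x m := by
  induction m with
  | zero =>
    refine ⟨1, fun _ => 0, fun j hj => by omega, by simp [greedyLength], by simp [greedyLength], ?_⟩
    rintro s hs
    obtain rfl : s = 0 := by omega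
    simp
  | succ m ih =>
    obtain ⟨t, g, h1, h2, h3, h4⟩ := ih fun i hi => hinj i (by omega)
    have hne := hinj m (by omega)
    have hss : smallSteps k x (m + 1) = smallSteps k x m +
        if x m < x (m + 1) + k ∧ x (m + 1) < x m + k then 1 else 0 := by
      rw [smallSteps, Finset.sum_range_succ, ← smallSteps]
    rw [greedyLength]
    by_cases hc : (Odd (greedyLength x m) ↔ x m < x (m + 1))
    · rw [if_pos hc]
      rcases t with _ | s
      · exact ⟨0, g, h1, h2, by omega, fun s hs => by omega⟩
      · obtain ⟨h5, h6⟩ := h4 s rfl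
        have hp : Even s ↔ x m < x (m + 1) := by
          rw [← hc, ← Nat.not_even_iff_odd, ← h2, Nat.even_add_one, not_not]
        by_cases hu : if Even s then x (g s) ≤ x (m + 1) else x (m + 1) ≤ x (g s)
        · refine ⟨s + 1, Function.update g s (m + 1), h1.update_last (by omega) hu, h2, by omega, ?_⟩
          intro s' hs'
          obtain rfl : s' = s := by omega
          simp
        · refine ⟨s + 1, g, h1, h2, by omega, ?_⟩
          intro s' hs'
          obtain rfl : s' = s := by omega
          refine ⟨by omega, ?_⟩
          split_ifs at * <;> omega
    · rw [if_neg hc]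
      rcases t with _ | s
      -- Nothing is left of the subsequence, so it restarts at the current position.
      · refine ⟨1, fun _ => m + 1, fun j hj => by omega, ?_, by omega, ?_⟩
        · simp [Nat.even_add_one, ← h2]
        · intro s hs
          obtain rfl : s = 0 := by omega
          simp
      · obtain ⟨h5, h6⟩ := h4 s rfl
        have hp : Even s ↔ x (m + 1) < x m := by
          have h7 : Even s ↔ Odd (greedyLength x m) := by
            rw [← Nat.not_even_iff_odd, ← h2, Nat.even_add_one, not_not]
          rw [h7]
          have : x (m + 1) < x m ↔ ¬ x m < x (m + 1) := by omega
          rw [this]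
          tauto
        by_cases hu : if Even s then x (m + 1) + k ≤ x (g s) else x (g s) + k ≤ x (m + 1)
        · refine ⟨s + 2, Function.update g (s + 1) (m + 1), h1.snoc (by omega) hu, ?_, by omega, ?_⟩
          · rw [Nat.even_add_one, h2, Nat.even_add_one]
          · intro s' hs'
            obtain rfl : s' = s + 1 := by omega
            simp
        -- The last chosen value is at least as extreme as `x m`, so a failed extension forces the
        -- present step to be small.
        · have hb : x m < x (m + 1) + k ∧ x (m + 1) < x m + k := by
            by_cases he : Even s
            · rw [if_pos he] at h6 hu
              have := hp.1 he; omega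
            · rw [if_neg he] at h6 hu
              have : ¬ x (m + 1) < x m := fun h => he (hp.2 h)
              omega
          rw [if_pos hb] at hss
          -- Dropping the last term restores the parity, at the cost of two. The gap `k` before the
          -- dropped term, together with the failed extension, shows that the new last term is again
          -- extreme enough.
          refine ⟨s, g, h1.mono (by omega), ?_, by omega, ?_⟩
          · rw [Nat.even_add_one, ← h2, Nat.even_add_one, not_not]
          · rintro s' rfl
            obtain ⟨h8, h9⟩ := h1 s' (by omega)
            refine ⟨by omega, ?_⟩
            simp only [Nat.even_add_one] at *
            split_ifs at * <;> omega

/-! ### Permutations as sequences, and local extrema -/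

/-- The values of a permutation, extended by zero. -/
def permSeq {n : ℕ} (σ : Equiv.Perm (Fin n)) (i : ℕ) : ℕ := if h : i < n then σ ⟨i, h⟩ else 0

theorem permSeq_of_lt {n : ℕ} (σ : Equiv.Perm (Fin n)) {i : ℕ} (h : i < n) :
    permSeq σ i = σ ⟨i, h⟩ := dif_pos h

theorem permSeq_injOn {n : ℕ} (σ : Equiv.Perm (Fin n)) {i j : ℕ} (hi : i < n) (hj : j < n)
    (h : permSeq σ i = permSeq σ j) : i = j := by
  rw [permSeq_of_lt σ hi, permSeq_of_lt σ hj] at h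
  simpa using σ.injective (Fin.ext h)

theorem AltSeq.lt_of_lt {k : ℕ} {x : ℕ → ℕ} {t : ℕ} {g : ℕ → ℕ} (h : AltSeq k x t g) {i j : ℕ}
    (hij : i < j) (hj : j < t) : g i < g j := by
  induction j, hij using Nat.le_induction with
  | base => exact (h i hj).1
  | succ j hij ih => exact (ih (by omega)).trans (h j hj).1

theorem longestKAlternating_le_greedyLength {k n : ℕ} (hk : 1 ≤ k)
    (σ : Equiv.Perm (Fin (n + 1))) :
    longestKAlternating k σ ≤ greedyLength (permSeq σ) n := by
  obtain ⟨i, hi, hi'⟩ := (longestKAlternating_isGreatest k σ).1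
  generalize longestKAlternating k σ = t at *
  rcases t with _ | t
  · omega
  let g : ℕ → ℕ := fun j => if h : j < t + 1 then i ⟨j, h⟩ else 0
  have hg : ∀ j (h : j < t + 1), g j = i ⟨j, h⟩ := fun j h => dif_pos h
  have hx : ∀ j (h : j < t + 1), permSeq σ (g j) = σ (i ⟨j, h⟩) := fun j h => by
    rw [hg j h, permSeq_of_lt σ (i ⟨j, h⟩).2]
  have ha : AltSeq k (permSeq σ) (t + 1) g := by
    intro j hj
    rw [hx j (by omega), hx (j + 1) hj, hg j (by omega), hg (j + 1) hj]
    exact ⟨hi (by simp), hi' j hj⟩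
  refine ((ha.mono_left hk).le_greedyLength n ?_).1
  rw [hg t (by omega)]
  omega

theorem greedyLength_le_longestKAlternating {k n : ℕ} (hk : 1 ≤ k)
    (σ : Equiv.Perm (Fin (n + 1))) :
    greedyLength (permSeq σ) n ≤ longestKAlternating k σ + 2 * smallSteps k (permSeq σ) n := by
  obtain ⟨t, g, h1, -, h3, h4⟩ := exists_altSeq_of_smallSteps (x := permSeq σ) hk n
    (fun i hi h => by have := permSeq_injOn σ (by omega) (by omega) h; omega)
  have hlt : ∀ j < t, g j < n + 1 := by
    intro j hj
    obtain ⟨s, rfl⟩ : ∃ s, t = s + 1 := ⟨t - 1, by omega⟩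
    have h5 := (h4 s rfl).1
    rcases Nat.lt_or_ge j s with h | h
    · have := h1.lt_of_lt h (by omega); omega
    · obtain rfl : j = s := by omega
      omega
  refine h3.trans (Nat.add_le_add_right ?_ _)
  refine (longestKAlternating_isGreatest k σ).2 ⟨fun j => ⟨g j, hlt j j.2⟩, ?_, ?_⟩
  · intro a b hab
    exact h1.lt_of_lt hab b.2
  · intro j hj
    have := (h1 j hj).2
    rwa [permSeq_of_lt σ (hlt _ hj), permSeq_of_lt σ (hlt j (by omega))] at this

/-- `turn a b c` is `1` if `b` is a local extremum of the sequence `a, b, c`. -/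
noncomputable def turn {α : Type*} [LT α] (a b c : α) : ℝ :=
  open Classical in if (a < b ↔ b < c) then 0 else 1

/-- Parity records the direction of the last step; hence the greedy length grows exactly where the
direction changes, that is, at a local extremum. -/
theorem odd_greedyLength_succ {x : ℕ → ℕ} (m : ℕ) :
    Odd (greedyLength x (m + 1)) ↔ x m < x (m + 1) := by
  rw [greedyLength]
  split_ifs with h
  · exact h
  · rw [Nat.odd_add_one]; tauto

theorem greedyLength_eq_sum_turn (x : ℕ → ℕ) (m : ℕ) :
    (greedyLength x (m + 1) : ℝ) = greedyLength x 1 +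
      ∑ i ∈ Finset.range m, turn (x i) (x (i + 1)) (x (i + 2)) := by
  induction m with
  | zero => simp
  | succ m ih =>
    rw [Finset.sum_range_succ, ← add_assoc, ← ih, greedyLength, turn]
    simp only [odd_greedyLength_succ]
    split_ifs <;> simp

theorem greedyLength_one_le (x : ℕ → ℕ) : greedyLength x 1 ≤ 2 := by
  rw [greedyLength, greedyLength]; split_ifs <;> omega

/-- The longest `k`-alternating subsequence is counted by the interior local extrema, up to the
number of small steps. -/
theorem abs_longestKAlternating_sub_sum_turn_le {k n : ℕ} (hk : 1 ≤ k)
    (σ : Equiv.Perm (Fin (n + 2))) :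
    |(longestKAlternating k σ : ℝ) - ∑ i ∈ Finset.range n,
      turn (permSeq σ i) (permSeq σ (i + 1)) (permSeq σ (i + 2))| ≤
      2 + 2 * smallSteps k (permSeq σ) (n + 1) := by
  have h1 := longestKAlternating_le_greedyLength hk σ
  have h2 := greedyLength_le_longestKAlternating hk σ
  have h3 := greedyLength_eq_sum_turn (permSeq σ) n
  have h4 := greedyLength_one_le (permSeq σ)
  have h1' : (longestKAlternating k σ : ℝ) ≤ greedyLength (permSeq σ) (n + 1) := by exact_mod_cast h1
  have h2' : (greedyLength (permSeq σ) (n + 1) : ℝ) ≤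
    longestKAlternating k σ + 2 * smallSteps k (permSeq σ) (n + 1) := by exact_mod_cast h2
  have h4' : (greedyLength (permSeq σ) 1 : ℝ) ≤ 2 := by exact_mod_cast h4
  have h5 : (0 : ℝ) ≤ greedyLength (permSeq σ) 1 := by positivity
  have h6 : (0 : ℝ) ≤ smallSteps k (permSeq σ) (n + 1) := by positivity
  rw [abs_le]
  constructor <;> linarith

/-! ### Second moment of the number of small steps -/

theorem integral_uniformPerm {n : ℕ} (f : Equiv.Perm (Fin n) → ℝ) :
    ∫ σ, f σ ∂(uniformPerm n) = (n.factorial : ℝ)⁻¹ * ∑ σ, f σ := by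
  rw [integral_fintype .of_finite, Finset.mul_sum]
  refine Finset.sum_congr rfl fun σ _ => ?_
  rw [smul_eq_mul]
  congr 1
  rw [Measure.real, uniformPerm, uniformOn_univ]
  simp [Fintype.card_perm]

/-- The indicator that the values of `σ` at `a` and `b` differ by less than `k`. -/
noncomputable def closeValues (k : ℕ) {n : ℕ} (a b : Fin n) (σ : Equiv.Perm (Fin n)) : ℝ :=
  if (σ a : ℕ) < σ b + k ∧ (σ b : ℕ) < σ a + k then 1 else 0

theorem closeValues_nonneg (k : ℕ) {n : ℕ} (a b : Fin n) (σ : Equiv.Perm (Fin n)) :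
    0 ≤ closeValues k a b σ := by
  unfold closeValues; split_ifs <;> simp

theorem closeValues_le_one (k : ℕ) {n : ℕ} (a b : Fin n) (σ : Equiv.Perm (Fin n)) :
    closeValues k a b σ ≤ 1 := by
  unfold closeValues; split_ifs <;> simp

theorem sum_closeValues_le (k : ℕ) {n : ℕ} (a : Fin n) (s : Finset (Fin n))
    (σ : Equiv.Perm (Fin n)) :
    ∑ m ∈ s, closeValues k a m σ ≤ 2 * k := by
  unfold closeValues
  rw [Finset.sum_boole]
  have : (s.filter fun m => (σ a : ℕ) < σ m + k ∧ (σ m : ℕ) < σ a + k).card ≤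
      (Finset.Ico (σ a + 1 - k : ℕ) (σ a + k)).card := by
    refine Finset.card_le_card_of_injOn (fun m => (σ m : ℕ)) ?_ ?_
    · intro m hm
      simp only [Finset.coe_filter, Set.mem_ofPred_eq] at hm
      simp only [Finset.coe_Ico, Set.mem_Ico]
      omega
    · intro m _ m' _ h
      exact σ.injective (Fin.ext h)
  rw [Nat.card_Ico] at this
  have h2 : (s.filter fun m => (σ a : ℕ) < σ m + k ∧ (σ m : ℕ) < σ a + k).card ≤ 2 * k := by omega
  exact_mod_cast h2

/-- Exchanging the value at `b` with all values outside `s` shows that it is rarely close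
to the value at `a ∈ s`, whatever happens on `s`. -/
theorem sum_mul_closeValues_le (k : ℕ) {n : ℕ} (s : Finset (Fin n)) {a b : Fin n} (ha : a ∈ s)
    (hb : b ∉ s) (g : Equiv.Perm (Fin n) → ℝ) (hg0 : ∀ σ, 0 ≤ g σ)
    (hg : ∀ m ∉ s, ∀ σ, g (σ * Equiv.swap b m) = g σ) :
    ((n : ℝ) - s.card) * ∑ σ, g σ * closeValues k a b σ ≤ 2 * k * ∑ σ, g σ := by
  have key : ∀ m ∈ sᶜ, ∑ σ, g σ * closeValues k a b σ = ∑ σ, g σ * closeValues k a m σ := by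
    intro m hm
    rw [Finset.mem_compl] at hm
    rw [← Equiv.sum_comp (Equiv.mulRight (Equiv.swap b m)) fun σ => g σ * closeValues k a b σ]
    refine Finset.sum_congr rfl fun σ _ => ?_
    rw [Equiv.coe_mulRight, hg m hm]
    congr 1
    have h1 : Equiv.swap b m a = a :=
      Equiv.swap_apply_of_ne_of_ne (fun h => hb (h ▸ ha)) (fun h => hm (h ▸ ha))
    simp only [closeValues, Equiv.Perm.mul_apply, h1, Equiv.swap_apply_left]
  have hcard : ((n : ℝ) - s.card) = (sᶜ.card : ℝ) := by
    rw [Finset.card_compl, Fintype.card_fin, Nat.cast_sub]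
    simpa using Finset.card_le_univ s
  rw [hcard, ← nsmul_eq_mul, ← Finset.sum_const, Finset.sum_congr rfl key, Finset.sum_comm,
    Finset.mul_sum]
  refine Finset.sum_le_sum fun σ _ => ?_
  rw [← Finset.mul_sum, mul_comm (2 * (k : ℝ))]
  exact mul_le_mul_of_nonneg_left (sum_closeValues_le k a _ σ) (hg0 σ)

theorem smallSteps_permSeq (k : ℕ) {n : ℕ} (σ : Equiv.Perm (Fin (n + 1))) :
    (smallSteps k (permSeq σ) n : ℝ) = ∑ i : Fin n, closeValues k i.castSucc i.succ σ := by
  rw [smallSteps, Finset.sum_range]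
  push_cast
  refine Finset.sum_congr rfl fun i _ => ?_
  rw [permSeq_of_lt σ (by omega), permSeq_of_lt σ (by omega)]
  rfl

theorem sum_closeValues_adjacent_le (k : ℕ) {n : ℕ} (i : Fin n) :
    n * ∑ σ, closeValues k i.castSucc i.succ σ ≤ 2 * k * (n + 1).factorial := by
  have := sum_mul_closeValues_le k {i.castSucc} (a := i.castSucc) (b := i.succ)
    (by simp) (by simp [Fin.ext_iff]) (fun _ => 1) (by simp) (by simp)
  simpa [Fintype.card_perm] using this

/-- The positions `i`, `i + 1`, `j` are frozen; `j + 1` is not among them, and its value can be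
exchanged over the remaining `n + 1 - 3` places without affecting the first indicator. -/
theorem sum_closeValues_adjacent_mul_le (k : ℕ) {n : ℕ} (i j : Fin n)
    (h : (i : ℕ) + 1 < j ∨ (j : ℕ) + 1 < i) :
    ((n : ℝ) - 2) * ∑ σ, closeValues k i.castSucc i.succ σ * closeValues k j.castSucc j.succ σ ≤
      2 * k * ∑ σ, closeValues k i.castSucc i.succ σ := by
  have := sum_mul_closeValues_le k {i.castSucc, i.succ, j.castSucc} (a := j.castSucc) (b := j.succ)
    (by simp) (by simp [Fin.ext_iff]; omega) (fun σ => closeValues k i.castSucc i.succ σ)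
    (fun σ => closeValues_nonneg _ _ _ _) ?_
  · refine le_trans (le_of_eq ?_) this
    congr 1
    rw [Finset.card_eq_three.2 ⟨i.castSucc, i.succ, j.castSucc, by simp [Fin.ext_iff],
      by simp [Fin.ext_iff]; omega, by simp [Fin.ext_iff]; omega, rfl⟩]
    push_cast; ring
  · intro m hm σ
    simp only [Finset.mem_insert, Finset.mem_singleton, not_or] at hm
    have h1 : Equiv.swap j.succ m i.castSucc = i.castSucc :=
      Equiv.swap_apply_of_ne_of_ne (by simp [Fin.ext_iff]; omega) (Ne.symm hm.1)
    have h2 : Equiv.swap j.succ m i.succ = i.succ :=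
      Equiv.swap_apply_of_ne_of_ne (by simp [Fin.ext_iff]; omega) (Ne.symm hm.2.1)
    simp only [closeValues, Equiv.Perm.mul_apply, h1, h2]

/-- The number of small steps of a random permutation has bounded second moment. -/
theorem integral_smallSteps_sq_le (k : ℕ) {n : ℕ} (hn : 3 ≤ n) :
    ∫ σ, (smallSteps k (permSeq σ) n : ℝ) ^ 2 ∂(uniformPerm (n + 1)) ≤ (3 + 6 * k) * (2 * k) := by
  have hn' : (3 : ℝ) ≤ n := by exact_mod_cast hn
  rw [integral_uniformPerm, inv_mul_le_iff₀ (by positivity)]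
  simp_rw [smallSteps_permSeq, sq, Finset.sum_mul_sum]
  rw [Finset.sum_comm]
  set F : Fin n → ℝ := fun i => ∑ σ, closeValues k i.castSucc i.succ σ with hF
  have hF0 : ∀ i, 0 ≤ F i := fun i => Finset.sum_nonneg fun σ _ => closeValues_nonneg _ _ _ _
  have hrow : ∀ i : Fin n, ∑ σ, ∑ j : Fin n,
      closeValues k i.castSucc i.succ σ * closeValues k j.castSucc j.succ σ ≤ (3 + 6 * k) * F i := by
    intro i
    rw [Finset.sum_comm]
    -- At most three `j` lie within distance one of `i`, where the trivial bound suffices; the other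
    -- pairs decouple.
    have hj : ∀ j : Fin n, ∑ σ, closeValues k i.castSucc i.succ σ * closeValues k j.castSucc j.succ σ
        ≤ (if (j : ℕ) ∈ Finset.Icc ((i : ℕ) - 1) (i + 1) then F i else 0) + 2 * k / (n - 2) * F i := by
      intro j
      split_ifs with h
      · refine le_add_of_le_of_nonneg (Finset.sum_le_sum fun σ _ => ?_) ?_
        · exact mul_le_of_le_one_right (closeValues_nonneg _ _ _ _) (closeValues_le_one _ _ _ _)
        · have := hF0 i
          have : (0 : ℝ) < n - 2 := by linarith
          positivity
      · rw [zero_add, div_mul_eq_mul_div, le_div_iff₀ (by linarith), mul_comm]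
        rw [Finset.mem_Icc] at h
        exact sum_closeValues_adjacent_mul_le k i j (by omega)
    refine (Finset.sum_le_sum fun j _ => hj j).trans ?_
    rw [Finset.sum_add_distrib, add_mul]
    refine add_le_add ?_ ?_
    · rw [← Finset.sum_filter, Finset.sum_const, nsmul_eq_mul]
      refine mul_le_mul_of_nonneg_right ?_ (hF0 i)
      have : (Finset.univ.filter fun j : Fin n => (j : ℕ) ∈ Finset.Icc ((i : ℕ) - 1) (i + 1)).card ≤
          (Finset.Icc ((i : ℕ) - 1) (i + 1)).card := by
        refine Finset.card_le_card_of_injOn (fun j => (j : ℕ)) ?_ ?_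
        · intro j hj
          simpa using hj
        · intro a _ b _ h
          exact Fin.ext h
      rw [Nat.card_Icc] at this
      have h3 : (Finset.univ.filter fun j : Fin n =>
        (j : ℕ) ∈ Finset.Icc ((i : ℕ) - 1) (i + 1)).card ≤ 3 := by omega
      exact_mod_cast h3
    · rw [Finset.sum_const, nsmul_eq_mul, Finset.card_univ, Fintype.card_fin, ← mul_assoc]
      refine mul_le_mul_of_nonneg_right ?_ (hF0 i)
      -- Here `n / (n - 2) ≤ 3`, because `n ≥ 3`.
      rw [mul_div_assoc', div_le_iff₀ (by linarith)]
      nlinarith [Nat.cast_nonneg (α := ℝ) k]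
  have hsum : ∑ i, F i ≤ 2 * k * (n + 1).factorial := by
    have h1 : ∀ i, F i ≤ 2 * k * (n + 1).factorial / n := fun i => by
      rw [le_div_iff₀ (by linarith), mul_comm]
      exact sum_closeValues_adjacent_le k i
    refine (Finset.sum_le_sum fun i _ => h1 i).trans (le_of_eq ?_)
    rw [Finset.sum_const, nsmul_eq_mul, Finset.card_univ, Fintype.card_fin]
    field_simp
  have h5 : ∑ i : Fin n, ∑ σ : Equiv.Perm (Fin (n + 1)), ∑ j : Fin n,
      closeValues k i.castSucc i.succ σ * closeValues k j.castSucc j.succ σ ≤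
      (3 + 6 * k) * ∑ i, F i := by
    rw [Finset.mul_sum]
    exact Finset.sum_le_sum fun i _ => hrow i
  refine h5.trans ((mul_le_mul_of_nonneg_left hsum (by positivity)).trans (le_of_eq (by ring)))

/-! ### From random permutations to i.i.d. sequences -/

section Transport

variable {ν : Measure ℝ} [IsProbabilityMeasure ν]

/-- By Fubini the diagonal is null for the product of two atomless laws. -/
theorem ae_injective_infinitePi [NullSingletonClass ν] (n : ℕ) :
    ∀ᵐ x ∂(Measure.infinitePi fun _ : Fin n => ν), Function.Injective x := by
  have h : ∀ i j : Fin n, i ≠ j → ∀ᵐ x ∂(Measure.infinitePi fun _ : Fin n => ν), x i ≠ x j := by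
    intro i j hij
    have h1 : (ν.prod ν) {p : ℝ × ℝ | p.1 = p.2} = 0 := by
      rw [Measure.measure_prod_null (measurableSet_eq_fun measurable_fst measurable_snd)]
      refine Eventually.of_forall fun a => ?_
      have : Prod.mk a ⁻¹' {p : ℝ × ℝ | p.1 = p.2} = {a} := by
        ext b; simp [eq_comm]
      simp [this]
    rw [← Measure.infinitePi_map_eval_prod (P := fun _ : Fin n => ν) hij,
      Measure.map_apply (by fun_prop) (measurableSet_eq_fun measurable_fst measurable_snd)] at h1
    rw [ae_iff]
    simpa using h1
  have h2 : ∀ᵐ x ∂(Measure.infinitePi fun _ : Fin n => ν), ∀ i j : Fin n, i ≠ j → x i ≠ x j := by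
    rw [ae_all_iff]; intro i
    rw [ae_all_iff]; intro j
    by_cases hij : i = j
    · simp [hij]
    · filter_upwards [h i j hij] with x hx _ using hx
  filter_upwards [h2] with x hx i j hij
  by_contra hne
  exact hx i j hne hij

theorem exists_perm_lt_iff_lt {n : ℕ} {x : Fin n → ℝ} (hx : Function.Injective x) :
    ∃ ρ : Equiv.Perm (Fin n), ∀ i j, x i < x j ↔ ρ i < ρ j := by
  have hs : StrictMono (x ∘ Tuple.sort x) :=
    (Tuple.monotone_sort x).strictMono_of_injective (hx.comp (Tuple.sort x).injective)
  refine ⟨(Tuple.sort x)⁻¹, fun i j => ?_⟩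
  rw [← hs.lt_iff_lt]
  simp

/-- A function of real tuples that depends only on the relative order of the entries. -/
def OrderInvariant {n : ℕ} {β : Type*} (G : (Fin n → ℝ) → β) : Prop :=
  ∀ x y, (∀ i j, x i < x j ↔ y i < y j) → G x = G y

/-- The permutation `σ`, read as a real tuple. -/
def permTuple {n : ℕ} (σ : Equiv.Perm (Fin n)) (i : Fin n) : ℝ := ((σ i : ℕ) : ℝ)

/-- By exchangeability the integral is unchanged under each reindexing `π`. Almost every `x` has a
rank permutation `ρ`, and `x ∘ π` is ordered like `ρ * π`, which runs over the whole symmetric group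
with `π`. -/
theorem lintegral_infinitePi_orderInvariant [NullSingletonClass ν] {n : ℕ} {G : (Fin n → ℝ) → ENNReal}
    (hG : Measurable G) (hG' : OrderInvariant G) :
    (n.factorial : ENNReal) * ∫⁻ x, G x ∂(Measure.infinitePi fun _ : Fin n => ν) =
      ∑ σ : Equiv.Perm (Fin n), G (permTuple σ) := by
  set Q := Measure.infinitePi fun _ : Fin n => ν
  have h1 : ∀ π : Equiv.Perm (Fin n), ∫⁻ x, G x ∂Q = ∫⁻ x, G (fun i => x (π i)) ∂Q := by
    intro π
    conv_lhs => rw [show Q = Q.map (fun x i => x (π i)) from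
      (Measure.map_infinitePi_infinitePi_of_inj (P := fun _ : Fin n => ν) π.injective).symm]
    rw [lintegral_map hG (by fun_prop)]
  calc (n.factorial : ENNReal) * ∫⁻ x, G x ∂Q
      = ∑ π : Equiv.Perm (Fin n), ∫⁻ x, G (fun i => x (π i)) ∂Q := by
        rw [← Finset.sum_congr rfl fun π _ => h1 π, Finset.sum_const, Finset.card_univ,
          Fintype.card_perm, Fintype.card_fin, nsmul_eq_mul]
    _ = ∫⁻ x, ∑ π : Equiv.Perm (Fin n), G (fun i => x (π i)) ∂Q := by
        rw [lintegral_finsetSum]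
        intro π _
        exact hG.comp (by fun_prop)
    _ = ∫⁻ _, ∑ σ : Equiv.Perm (Fin n), G (permTuple σ) ∂Q := by
        refine lintegral_congr_ae ?_
        filter_upwards [ae_injective_infinitePi (ν := ν) n] with x hx
        obtain ⟨ρ, hρ⟩ := exists_perm_lt_iff_lt hx
        rw [← Equiv.sum_comp (Equiv.mulLeft ρ) fun σ => G (permTuple σ)]
        refine Finset.sum_congr rfl fun π _ => hG' _ _ fun i j => ?_
        rw [hρ]
        simp [permTuple]
    _ = _ := by simp

theorem identDistrib_orderInvariant [NullSingletonClass ν] {n : ℕ} {G : (Fin n → ℝ) → ℝ}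
    (hG : Measurable G) (hG' : OrderInvariant G) :
    IdentDistrib G (fun σ => G (permTuple σ)) (Measure.infinitePi fun _ : Fin n => ν)
      (uniformPerm n) where
  aemeasurable_fst := hG.aemeasurable
  aemeasurable_snd := Measurable.of_discrete.aemeasurable
  map_eq := by
    classical
    ext s hs
    rw [Measure.map_apply hG hs, Measure.map_apply Measurable.of_discrete hs]
    have h := lintegral_infinitePi_orderInvariant (ν := ν)
      (G := fun x => (G ⁻¹' s).indicator 1 x) (measurable_one.indicator (hG hs))
      (fun x y hxy => by simp only [Set.indicator, Set.mem_preimage, hG' x y hxy, Pi.one_apply])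
    rw [lintegral_indicator_one (hG hs)] at h
    have h0 : (n.factorial : ENNReal) ≠ 0 := by simpa using n.factorial_ne_zero
    have h2 : ((n.factorial : ENNReal)) ≠ ⊤ := ENNReal.natCast_ne_top _
    rw [ENNReal.eq_div_iff h0 h2 |>.2 h, uniformPerm, uniformOn_univ, Fintype.card_perm,
      Fintype.card_fin, ← lintegral_indicator_one .of_discrete, lintegral_count, tsum_fintype]
    rfl

theorem identDistrib_window [NullSingletonClass ν] {n : ℕ} {G : (Fin n → ℝ) → ℝ}
    (hG : Measurable G) (hG' : OrderInvariant G) (s : ℕ) :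
    IdentDistrib (fun ω : ℕ → ℝ => G fun i : Fin n => ω (s + i)) (fun σ => G (permTuple σ))
      (Measure.infinitePi fun _ : ℕ => ν) (uniformPerm n) := by
  have h : IdentDistrib (fun (ω : ℕ → ℝ) (i : Fin n) => ω (s + i)) id
      (Measure.infinitePi fun _ : ℕ => ν) (Measure.infinitePi fun _ : Fin n => ν) := by
    refine ⟨Measurable.aemeasurable (by fun_prop), aemeasurable_id, ?_⟩
    rw [Measure.map_id, Measure.map_infinitePi_infinitePi_of_inj (P := fun _ : ℕ => ν)]
    intro i j hij
    simpa [Fin.ext_iff] using hij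
  exact (h.comp hG).trans (identDistrib_orderInvariant hG hG')

/-- Families of coordinates with disjoint index sets are independent. -/
theorem iIndepFun_blocks {ι κ : Type*} {f : ι → κ → ℕ}
    (hf : Function.Injective fun p : ι × κ => f p.1 p.2) :
    iIndepFun (fun (j : ι) (ω : ℕ → ℝ) (r : κ) => ω (f j r)) (Measure.infinitePi fun _ : ℕ => ν) := by
  have hfj : ∀ j, Function.Injective (f j) := fun j a b hab => by
    have := @hf (j, a) (j, b) hab
    simpa using this
  rw [iIndepFun_iff_map_fun_eq_infinitePi_map (by fun_prop)]
  simp_rw [fun j => Measure.map_infinitePi_infinitePi_of_inj (P := fun _ : ℕ => ν) (hfj j)]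
  rw [← Measure.infinitePi_map_curry (X := ℝ) (fun (_ : ι) (_ : κ) => ν),
    ← Measure.map_infinitePi_infinitePi_of_inj (P := fun _ : ℕ => ν) hf,
    Measure.map_map (by fun_prop) (by fun_prop)]
  rfl

end Transport

/-! ### Centred extremum indicators and their covariances -/

/-- The centred indicator that `x` has a local extremum at `i + 1`. -/
noncomputable def centredTurn (i : ℕ) (x : ℕ → ℝ) : ℝ := turn (x i) (x (i + 1)) (x (i + 2)) - 2 / 3

/-- A finite tuple, extended by zero. -/
def tupleSeq {n : ℕ} (x : Fin n → ℝ) (i : ℕ) : ℝ := if h : i < n then x ⟨i, h⟩ else 0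

theorem tupleSeq_of_lt {n : ℕ} (x : Fin n → ℝ) {i : ℕ} (h : i < n) : tupleSeq x i = x ⟨i, h⟩ :=
  dif_pos h

theorem measurable_turn : Measurable fun p : ℝ × ℝ × ℝ => turn p.1 p.2.1 p.2.2 := by
  classical
  have h1 : MeasurableSet {p : ℝ × ℝ × ℝ | p.1 < p.2.1} :=
    measurableSet_lt (by fun_prop) (by fun_prop)
  have h2 : MeasurableSet {p : ℝ × ℝ × ℝ | p.2.1 < p.2.2} :=
    measurableSet_lt (by fun_prop) (by fun_prop)
  unfold turn
  refine Measurable.ite ?_ measurable_const measurable_const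
  exact h1.iff h2

theorem measurable_centredTurn (i : ℕ) : Measurable (centredTurn i) := by
  unfold centredTurn
  have : Measurable fun x : ℕ → ℝ => (x i, x (i + 1), x (i + 2)) := by fun_prop
  exact (measurable_turn.comp this).sub_const _

theorem measurable_tupleSeq {n : ℕ} : Measurable (tupleSeq (n := n)) := by
  refine measurable_pi_lambda _ fun i => ?_
  unfold tupleSeq
  split_ifs <;> fun_prop

theorem abs_centredTurn_le (i : ℕ) (x : ℕ → ℝ) : |centredTurn i x| ≤ 1 := by
  unfold centredTurn turn
  split_ifs <;> norm_num [abs_le]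

theorem turn_congr {α β : Type*} [LT α] [LT β] {a b c : α} {a' b' c' : β} (h : a < b ↔ a' < b')
    (h' : b < c ↔ b' < c') : turn a b c = turn a' b' c' := by
  unfold turn; split_ifs <;> tauto

theorem orderInvariant_centredTurn {n i : ℕ} (h : i + 2 < n) :
    OrderInvariant fun x : Fin n → ℝ => centredTurn i (tupleSeq x) := by
  intro x y hxy
  simp only [centredTurn]
  congr 1
  apply turn_congr <;>
  · rw [tupleSeq_of_lt x (by omega), tupleSeq_of_lt x (by omega), tupleSeq_of_lt y (by omega),
      tupleSeq_of_lt y (by omega)]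
    exact hxy _ _

theorem centredTurn_window {n i : ℕ} (h : i + 2 < n) (s : ℕ) (ω : ℕ → ℝ) :
    centredTurn i (tupleSeq fun r : Fin n => ω (s + r)) = centredTurn (s + i) ω := by
  simp only [centredTurn]
  rw [tupleSeq_of_lt _ (by omega), tupleSeq_of_lt _ (by omega), tupleSeq_of_lt _ (by omega)]
  rfl

theorem centredTurn_permTuple {n i : ℕ} (h : i + 2 < n) (σ : Equiv.Perm (Fin n)) :
    centredTurn i (tupleSeq (permTuple σ)) =
      turn (permSeq σ i) (permSeq σ (i + 1)) (permSeq σ (i + 2)) - 2 / 3 := by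
  simp only [centredTurn]
  congr 1
  apply turn_congr <;>
  · rw [tupleSeq_of_lt _ (by omega), tupleSeq_of_lt _ (by omega), permSeq_of_lt _ (by omega),
      permSeq_of_lt _ (by omega)]
    simp [permTuple]

section Moments

variable {ν : Measure ℝ} [IsProbabilityMeasure ν]

/-- Sums of consecutive centred turns are identically distributed for random sequences and
random permutations. -/
theorem identDistrib_sum_centredTurn [NullSingletonClass ν] (m s : ℕ) :
    IdentDistrib (fun ω : ℕ → ℝ => ∑ i ∈ Finset.range m, centredTurn (s + i) ω)
      (fun σ : Equiv.Perm (Fin (m + 2)) => ∑ i ∈ Finset.range m,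
        (turn (permSeq σ i) (permSeq σ (i + 1)) (permSeq σ (i + 2)) - 2 / 3))
      (Measure.infinitePi fun _ : ℕ => ν) (uniformPerm (m + 2)) := by
  have h := identDistrib_window (ν := ν) (n := m + 2)
    (G := fun x => ∑ i ∈ Finset.range m, centredTurn i (tupleSeq x))
    (Finset.measurable_fun_sum _ fun i _ => (measurable_centredTurn i).comp measurable_tupleSeq)
    (fun x y hxy => Finset.sum_congr rfl fun i hi =>
      orderInvariant_centredTurn (by rw [Finset.mem_range] at hi; omega) x y hxy) s
  convert! h using 2
  · refine Finset.sum_congr rfl fun i hi => ?_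
    rw [Finset.mem_range] at hi
    rw [centredTurn_window (by omega)]
  · refine Finset.sum_congr rfl fun i hi => ?_
    rw [Finset.mem_range] at hi
    rw [centredTurn_permTuple (by omega)]

theorem integral_centredTurn_mul_eq [NullSingletonClass ν] {n i j : ℕ} (hi : i + 2 < n) (hj : j + 2 < n) (s : ℕ) :
    ∫ ω, centredTurn (s + i) ω * centredTurn (s + j) ω ∂(Measure.infinitePi fun _ : ℕ => ν) =
    (n.factorial : ℝ)⁻¹ * ∑ σ : Equiv.Perm (Fin n),
        (turn (permSeq σ i) (permSeq σ (i + 1)) (permSeq σ (i + 2)) - 2 / 3) *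
        (turn (permSeq σ j) (permSeq σ (j + 1)) (permSeq σ (j + 2)) - 2 / 3) := by
  have h := (identDistrib_window (ν := ν) (n := n)
    (G := fun x => centredTurn i (tupleSeq x) * centredTurn j (tupleSeq x))
    (((measurable_centredTurn i).comp measurable_tupleSeq).mul
      ((measurable_centredTurn j).comp measurable_tupleSeq))
    (fun x y hxy => by
      have h1 := orderInvariant_centredTurn hi x y hxy
      have h2 := orderInvariant_centredTurn hj x y hxy
      simp only at h1 h2 ⊢
      rw [h1, h2]) s).integral_eq
  rw [integral_uniformPerm] at h
  simpa only [centredTurn_window hi, centredTurn_window hj, centredTurn_permTuple hi,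
    centredTurn_permTuple hj] using h

end Moments

/-- A computable form of `turn`, centred and scaled to integer values. -/
def turnInt (a b c : ℕ) : ℤ := if (a < b ↔ b < c) then -2 else 1

theorem turn_sub_eq_turnInt (a b c : ℕ) : turn a b c - 2 / 3 = turnInt a b c / 3 := by
  unfold turn turnInt; split_ifs <;> norm_num

/-- Four of the six orders of three values have a middle extremum, whence the mean `2/3`. Lags 0, 1,
2 involve 3, 4, 5 letters; dividing the enumerated sums below by `9 * n!` yields the covariances
`2/9`, `-1/36`, `1/180`. -/
theorem sum_turnInt_zero : ∑ σ : Equiv.Perm (Fin 3),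
    turnInt (permSeq σ 0) (permSeq σ 1) (permSeq σ 2) = 0 := by decide +kernel

theorem sum_turnInt_sq : ∑ σ : Equiv.Perm (Fin 3),
    turnInt (permSeq σ 0) (permSeq σ 1) (permSeq σ 2) *
    turnInt (permSeq σ 0) (permSeq σ 1) (permSeq σ 2) = 12 := by decide +kernel

theorem sum_turnInt_mul_one : ∑ σ : Equiv.Perm (Fin 4),
    turnInt (permSeq σ 0) (permSeq σ 1) (permSeq σ 2) *
    turnInt (permSeq σ 1) (permSeq σ 2) (permSeq σ 3) = -6 := by decide +kernel

theorem sum_turnInt_mul_two : ∑ σ : Equiv.Perm (Fin 5),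
    turnInt (permSeq σ 0) (permSeq σ 1) (permSeq σ 2) *
    turnInt (permSeq σ 2) (permSeq σ 3) (permSeq σ 4) = 6 := by decide +kernel

section Covariance

variable {ν : Measure ℝ} [IsProbabilityMeasure ν]

theorem integral_centredTurn [NullSingletonClass ν] (s : ℕ) :
    ∫ ω, centredTurn s ω ∂(Measure.infinitePi fun _ : ℕ => ν) = 0 := by
  have h := (identDistrib_sum_centredTurn (ν := ν) 1 s).integral_eq
  simp only [Finset.sum_range_one, integral_uniformPerm, turn_sub_eq_turnInt, add_zero,
    zero_add] at h
  rw [h, ← Finset.sum_div, ← Int.cast_sum, sum_turnInt_zero]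
  simp

theorem integral_centredTurn_sq [NullSingletonClass ν] (s : ℕ) :
    ∫ ω, centredTurn s ω * centredTurn s ω ∂(Measure.infinitePi fun _ : ℕ => ν) = 2 / 9 := by
  have h := integral_centredTurn_mul_eq (ν := ν) (n := 3) (i := 0) (j := 0) (by omega) (by omega) s
  simp only [turn_sub_eq_turnInt, add_zero, zero_add, div_mul_div_comm, ← Finset.sum_div,
    ← Int.cast_mul, ← Int.cast_sum, sum_turnInt_sq] at h
  rw [h]; norm_num [Nat.factorial]

theorem integral_centredTurn_mul_one [NullSingletonClass ν] (s : ℕ) :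
    ∫ ω, centredTurn s ω * centredTurn (s + 1) ω ∂(Measure.infinitePi fun _ : ℕ => ν) =
      -1 / 36 := by
  have h := integral_centredTurn_mul_eq (ν := ν) (n := 4) (i := 0) (j := 1) (by omega) (by omega) s
  simp only [turn_sub_eq_turnInt, add_zero, zero_add, div_mul_div_comm, ← Finset.sum_div,
    ← Int.cast_mul, ← Int.cast_sum, Nat.reduceAdd, sum_turnInt_mul_one] at h
  rw [h]; norm_num [Nat.factorial]

theorem integral_centredTurn_mul_two [NullSingletonClass ν] (s : ℕ) :
    ∫ ω, centredTurn s ω * centredTurn (s + 2) ω ∂(Measure.infinitePi fun _ : ℕ => ν) =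
      1 / 180 := by
  have h := integral_centredTurn_mul_eq (ν := ν) (n := 5) (i := 0) (j := 2) (by omega) (by omega) s
  simp only [turn_sub_eq_turnInt, add_zero, zero_add, div_mul_div_comm, ← Finset.sum_div,
    ← Int.cast_mul, ← Int.cast_sum, Nat.reduceAdd, sum_turnInt_mul_two] at h
  rw [h]; norm_num [Nat.factorial]

theorem memLp_centredTurn (s : ℕ) (p : ENNReal) :
    MemLp (centredTurn s) p (Measure.infinitePi fun _ : ℕ => ν) :=
  MemLp.of_bound (measurable_centredTurn s).aestronglyMeasurable 1
    (Eventually.of_forall fun ω => abs_centredTurn_le s ω)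

theorem integrable_centredTurn_mul (s t : ℕ) :
    Integrable (fun ω => centredTurn s ω * centredTurn t ω) (Measure.infinitePi fun _ : ℕ => ν) :=
  (memLp_centredTurn s 2).integrable_mul (memLp_centredTurn t 2)

/-- The two windows of three coordinates are disjoint, so the factors are independent and centred.
-/
theorem integral_centredTurn_mul_far [NullSingletonClass ν] {s t : ℕ} (h : s + 3 ≤ t) :
    ∫ ω, centredTurn s ω * centredTurn t ω ∂(Measure.infinitePi fun _ : ℕ => ν) = 0 := by
  have hf : Function.Injective fun p : Bool × Fin 3 => (if p.1 then s else t) + (p.2 : ℕ) := by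
    rintro ⟨a, i⟩ ⟨b, j⟩ hab
    rcases a <;> rcases b <;> simp only [Prod.mk.injEq, Fin.ext_iff, if_true, if_false,
      Bool.false_eq_true, reduceCtorEq, true_and, false_and] at hab ⊢ <;> omega
  have h1 := (iIndepFun_blocks (ν := ν) (f := fun (b : Bool) (r : Fin 3) =>
    (if b then s else t) + (r : ℕ)) hf).indepFun (show true ≠ false by simp)
  have h2 := h1.comp ((measurable_centredTurn 0).comp measurable_tupleSeq)
    ((measurable_centredTurn 0).comp measurable_tupleSeq)
  have h3 : IndepFun (centredTurn s) (centredTurn t) (Measure.infinitePi fun _ : ℕ => ν) := by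
    exact h2
  rw [h3.integral_fun_mul_eq_mul_integral (measurable_centredTurn s).aestronglyMeasurable
    (measurable_centredTurn t).aestronglyMeasurable, integral_centredTurn, zero_mul]

theorem integrable_sum_centredTurn_sq (m s : ℕ) :
    Integrable (fun ω => (∑ i ∈ Finset.range m, centredTurn (s + i) ω) ^ 2)
      (Measure.infinitePi fun _ : ℕ => ν) :=
  (memLp_finsetSum _ fun i _ => memLp_centredTurn (s + i) 2).integrable_sq

theorem integral_sum_centredTurn [NullSingletonClass ν] (m s : ℕ) :
    ∫ ω, (∑ i ∈ Finset.range m, centredTurn (s + i) ω) ∂(Measure.infinitePi fun _ : ℕ => ν) = 0 := by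
  rw [integral_finsetSum _ fun i _ => (memLp_centredTurn (s + i) 1).integrable le_rfl]
  simp [integral_centredTurn]

/-- Each new term correlates only with itself and the two preceding ones, adding `2/9 + 2 * (1/180 -
1/36) = 8/45`. Starting from two terms ensures that both lags are present. -/
theorem integral_sum_centredTurn_sq [NullSingletonClass ν] (m s : ℕ) :
    ∫ ω, (∑ i ∈ Finset.range (m + 2), centredTurn (s + i) ω) ^ 2
      ∂(Measure.infinitePi fun _ : ℕ => ν) = 7 / 18 + 8 / 45 * m := by
  induction m with
  | zero =>
    have e : ∀ ω, (∑ i ∈ Finset.range 2, centredTurn (s + i) ω) ^ 2 =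
        centredTurn s ω * centredTurn s ω + 2 * (centredTurn s ω * centredTurn (s + 1) ω) +
        centredTurn (s + 1) ω * centredTurn (s + 1) ω := by
      intro ω; simp only [Finset.sum_range_succ, Finset.sum_range_zero, add_zero]; ring
    simp_rw [zero_add, e]
    rw [integral_add ((integrable_centredTurn_mul _ _).fun_add
      ((integrable_centredTurn_mul _ _).const_mul _)) (integrable_centredTurn_mul _ _),
      integral_add (integrable_centredTurn_mul _ _) ((integrable_centredTurn_mul _ _).const_mul _),
      integral_const_mul, integral_centredTurn_sq, integral_centredTurn_sq,
      integral_centredTurn_mul_one]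
    norm_num
  | succ m ih =>
    have e : ∀ ω, (∑ i ∈ Finset.range (m + 1 + 2), centredTurn (s + i) ω) ^ 2 =
        (∑ i ∈ Finset.range (m + 2), centredTurn (s + i) ω) ^ 2 +
        2 * (∑ i ∈ Finset.range (m + 2), centredTurn (s + i) ω * centredTurn (s + (m + 2)) ω) +
        centredTurn (s + (m + 2)) ω * centredTurn (s + (m + 2)) ω := by
      intro ω
      rw [Finset.sum_range_succ, ← Finset.sum_mul]
      ring
    have hsum : ∫ ω, ∑ i ∈ Finset.range (m + 2), centredTurn (s + i) ω * centredTurn (s + (m + 2)) ω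
        ∂(Measure.infinitePi fun _ : ℕ => ν) = 1 / 180 - 1 / 36 := by
      rw [integral_finsetSum _ fun i _ => integrable_centredTurn_mul _ _, Finset.sum_range_succ,
        Finset.sum_range_succ, Finset.sum_eq_zero, show s + (m + 2) = s + m + 2 by ring,
        integral_centredTurn_mul_two, show s + m + 2 = s + (m + 1) + 1 by ring,
        integral_centredTurn_mul_one]
      · norm_num
      · intro i hi
        rw [Finset.mem_range] at hi
        exact integral_centredTurn_mul_far (by omega)
    have hint : Integrable (fun ω => ∑ i ∈ Finset.range (m + 2),
        centredTurn (s + i) ω * centredTurn (s + (m + 2)) ω) (Measure.infinitePi fun _ : ℕ => ν) :=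
      integrable_finsetSum _ fun i _ => integrable_centredTurn_mul _ _
    simp_rw [e]
    rw [integral_add ((integrable_sum_centredTurn_sq _ _).fun_add (hint.const_mul _))
      (integrable_centredTurn_mul _ _),
      integral_add (integrable_sum_centredTurn_sq _ _) (hint.const_mul _), integral_const_mul, hsum,
      ih, integral_centredTurn_sq]
    push_cast; ring

end Covariance

/-! ### Characteristic function estimates -/

-- Interchange of limits: `L` will govern the block length, and the approximation error need only
-- vanish when first `n` and then `L` tends to infinity.
open scoped Topology in
theorem tendsto_of_tendsto_of_norm_sub_le {a c : ℕ → ℂ} {b : ℕ → ℕ → ℂ} {δ : ℕ → ℕ → ℝ}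
    {d : ℕ → ℝ} {l : ℂ} (hb : ∀ᶠ L in atTop, Tendsto (b L) atTop (𝓝 (c L)))
    (hab : ∀ᶠ L in atTop, ∀ᶠ n in atTop, ‖a n - b L n‖ ≤ δ L n)
    (hδ : ∀ᶠ L in atTop, Tendsto (δ L) atTop (𝓝 (d L))) (hd : Tendsto d atTop (𝓝 0))
    (hc : Tendsto c atTop (𝓝 l)) : Tendsto a atTop (𝓝 l) := by
  rw [Metric.tendsto_nhds]
  intro ε hε
  have h1 : ∀ᶠ L in atTop, d L < ε / 4 := hd.eventually_lt_const (by linarith)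
  have h2 : ∀ᶠ L in atTop, dist (c L) l < ε / 4 := Metric.tendsto_nhds.1 hc _ (by linarith)
  obtain ⟨L, hbL, habL, hδL, h1L, h2L⟩ := (hb.and (hab.and (hδ.and (h1.and h2)))).exists
  filter_upwards [Metric.tendsto_nhds.1 hbL (ε / 4) (by linarith), habL,
    hδL.eventually_lt_const h1L] with n h3 h4 h5
  calc dist (a n) l ≤ dist (a n) (b L n) + dist (b L n) (c L) + dist (c L) l := dist_triangle4 _ _ _ _
    _ < ε := by rw [dist_eq_norm (a n)]; linarith

section CharFun

variable {Ω : Type*} {mΩ : MeasurableSpace Ω} {μ : Measure Ω} [IsProbabilityMeasure μ]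

/-- The map `x ↦ exp (i t x)` is `|t|`-Lipschitz. -/
theorem norm_charFun_map_sub_le {X Y : Ω → ℝ} (hX : AEMeasurable X μ) (hY : AEMeasurable Y μ)
    (hXY : Integrable (fun ω => X ω - Y ω) μ) (t : ℝ) :
    ‖charFun (μ.map X) t - charFun (μ.map Y) t‖ ≤ |t| * ∫ ω, |X ω - Y ω| ∂μ := by
  have hint : ∀ {Z : Ω → ℝ}, AEMeasurable Z μ →
      Integrable (fun ω => Complex.exp (t * Z ω * Complex.I)) μ := by
    intro Z hZ
    refine Integrable.of_bound (C := 1) ?_ ?_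
    · exact AEMeasurable.aestronglyMeasurable (by fun_prop)
    · refine Eventually.of_forall fun ω => ?_
      rw [← Complex.ofReal_mul, Complex.norm_exp_ofReal_mul_I]
  rw [charFun_apply_real, charFun_apply_real, integral_map hX (by fun_prop),
    integral_map hY (by fun_prop), ← integral_sub (hint hX) (hint hY), ← integral_const_mul]
  refine norm_integral_le_of_norm_le (hXY.abs.const_mul _) (Eventually.of_forall fun ω => ?_)
  have e : Complex.exp (t * X ω * Complex.I) - Complex.exp (t * Y ω * Complex.I) =
      Complex.exp (((t * Y ω : ℝ) : ℂ) * Complex.I) *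
        (Complex.exp (Complex.I * ((t * (X ω - Y ω) : ℝ) : ℂ)) - 1) := by
    rw [mul_sub, ← Complex.exp_add, mul_one]
    push_cast
    ring_nf
  rw [e, norm_mul, Complex.norm_exp_ofReal_mul_I, one_mul, ← abs_mul]
  exact Real.norm_exp_I_mul_ofReal_sub_one_le

/-- This integrates `2|x| ≤ c + x² / c`; it replaces the Cauchy–Schwarz inequality when `c` has the
order of the standard deviation. -/
theorem integral_abs_le_of_sq {X : Ω → ℝ} (hX : MemLp X 2 μ) {c : ℝ} (hc : 0 < c) :
    ∫ ω, |X ω| ∂μ ≤ (c + (∫ ω, X ω ^ 2 ∂μ) / c) / 2 := by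
  have h : ∫ ω, |X ω| ∂μ ≤ ∫ ω, (c + X ω ^ 2 / c) / 2 ∂μ := by
    refine integral_mono (hX.integrable (by norm_num)).abs
      (((integrable_const c).add (hX.integrable_sq.div_const c)).div_const 2) fun ω => ?_
    have h1 : 0 ≤ (|X ω| - c) ^ 2 / c := by positivity
    have h2 : (|X ω| - c) ^ 2 / c = X ω ^ 2 / c - 2 * |X ω| + c := by
      rw [← sq_abs (X ω)]; field_simp; ring
    simp only
    linarith
  rwa [integral_div, integral_add (integrable_const c) (hX.integrable_sq.div_const c),
    integral_div, integral_const, probReal_univ, one_smul] at h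

open scoped Topology in
/-- The central limit theorem in terms of characteristic functions. -/
theorem tendsto_charFun_of_iIndepFun {X : ℕ → Ω → ℝ} (hX : MemLp (X 0) 2 μ)
    (hindep : iIndepFun X μ) (hident : ∀ i, IdentDistrib (X i) (X 0) μ μ) (h0 : μ[X 0] = 0)
    (t : ℝ) :
    Tendsto (fun n : ℕ => charFun (μ.map fun ω => (√n)⁻¹ * ∑ j ∈ Finset.range n, X j ω) t) atTop
      (𝓝 (Complex.exp (-((∫ ω, X 0 ω ^ 2 ∂μ : ℝ) * t ^ 2 / 2)))) := by
  have h := (tendstoInDistribution_inv_sqrt_mul_sum_sub (Y := id)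
    (P' := gaussianReal 0 Var[X 0; μ].toNNReal) ⟨aemeasurable_id, Measure.map_id⟩ hX hindep
    hident).tendsto
  have h1 := ProbabilityMeasure.tendsto_iff_tendsto_charFun.1 h t
  simp only [ProbabilityMeasure.coe_mk, Measure.map_id, charFun_gaussianReal, h0, mul_zero,
    sub_zero, Complex.ofReal_zero, zero_mul, zero_sub] at h1
  rw [Real.coe_toNNReal _ (variance_nonneg _ _),
    variance_of_integral_eq_zero hX.aemeasurable h0] at h1
  exact h1

end CharFun

/-! ### Independent blocks -/

section Blocks

variable {ν : Measure ℝ} [IsProbabilityMeasure ν]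

theorem memLp_sum_centredTurn (m s : ℕ) (p : ENNReal) :
    MemLp (fun ω => ∑ i ∈ Finset.range m, centredTurn (s + i) ω) p
      (Measure.infinitePi fun _ : ℕ => ν) :=
  memLp_finsetSum _ fun i _ => memLp_centredTurn (s + i) p

/-- A block of `m` indicators reads `m + 2` coordinates, so blocks repeated with period `L ≥ m + 2`
read disjoint sets. -/
theorem iIndepFun_sum_centredTurn {m L : ℕ} (h : m + 2 ≤ L) (d : ℕ) :
    iIndepFun (fun (j : ℕ) (ω : ℕ → ℝ) => ∑ i ∈ Finset.range m, centredTurn (j * L + d + i) ω)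
      (Measure.infinitePi fun _ : ℕ => ν) := by
  have hf : Function.Injective fun p : ℕ × Fin L => p.1 * L + d + (p.2 : ℕ) := by
    rintro ⟨a, i⟩ ⟨b, j⟩ hab
    simp only at hab
    have h1 : a * L + i = b * L + j := by omega
    have hL : 0 < L := by omega
    have h2 : a = b := by
      have := congrArg (· / L) h1
      simpa [Nat.add_div_of_dvd_right, Nat.mul_add_div, mul_comm _ L, hL,
        Nat.div_eq_of_lt i.2, Nat.div_eq_of_lt j.2] using this
    subst h2
    simp only [Prod.mk.injEq, true_and, Fin.ext_iff]
    omega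
  have h1 := (iIndepFun_blocks (ν := ν) (f := fun (j : ℕ) (r : Fin L) => j * L + d + (r : ℕ))
    hf).comp (fun _ x => ∑ i ∈ Finset.range m, centredTurn i (tupleSeq x))
    (fun _ => Finset.measurable_fun_sum _ fun i _ =>
      (measurable_centredTurn i).comp measurable_tupleSeq)
  convert! h1 using 2 with j
  funext ω
  refine Finset.sum_congr rfl fun i hi => ?_
  rw [Finset.mem_range] at hi
  exact (centredTurn_window (by omega) _ ω).symm

theorem identDistrib_sum_centredTurn_shift [NullSingletonClass ν] (m s t : ℕ) :
    IdentDistrib (fun ω : ℕ → ℝ => ∑ i ∈ Finset.range m, centredTurn (s + i) ω)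
      (fun ω : ℕ → ℝ => ∑ i ∈ Finset.range m, centredTurn (t + i) ω)
      (Measure.infinitePi fun _ : ℕ => ν) (Measure.infinitePi fun _ : ℕ => ν) :=
  (identDistrib_sum_centredTurn m s).trans (identDistrib_sum_centredTurn m t).symm

/-- Independence makes the block variances add up. -/
theorem integral_sum_blocks_sq [NullSingletonClass ν] {m L : ℕ} (h : m + 4 ≤ L) (d q : ℕ) :
    ∫ ω, (∑ j ∈ Finset.range q, ∑ i ∈ Finset.range (m + 2), centredTurn (j * L + d + i) ω) ^ 2
      ∂(Measure.infinitePi fun _ : ℕ => ν) = q * (7 / 18 + 8 / 45 * m) := by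
  have hmem : ∀ j, MemLp (fun ω : ℕ → ℝ => ∑ i ∈ Finset.range (m + 2),
      centredTurn (j * L + d + i) ω) 2 (Measure.infinitePi fun _ : ℕ => ν) :=
    fun j => memLp_sum_centredTurn _ _ 2
  have h1 := IndepFun.variance_sum (s := Finset.range q) (fun j _ => hmem j)
    (fun i _ j _ hij => (iIndepFun_sum_centredTurn (ν := ν) (m := m + 2) h d).indepFun hij)
  rw [variance_of_integral_eq_zero] at h1
  · simp only [Finset.sum_apply] at h1
    rw [h1, Finset.sum_congr rfl fun j _ => variance_of_integral_eq_zero (hmem j).aemeasurable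
      (integral_sum_centredTurn _ _), Finset.sum_congr rfl fun j _ =>
      integral_sum_centredTurn_sq (ν := ν) m (j * L + d), Finset.sum_const,
      Finset.card_range, nsmul_eq_mul]
  · exact Finset.aemeasurable_sum _ fun j _ => (hmem j).aemeasurable
  · simp only [Finset.sum_apply]
    rw [integral_finsetSum _ fun j _ => (hmem j).integrable (by norm_num)]
    simp only [integral_sum_centredTurn, Finset.sum_const_zero]

/-- Splitting a sum into blocks of length `m + 2`, each with a separating gap of length two,
and a remainder. -/
theorem sum_range_eq_sum_blocks (y : ℕ → ℝ) (m n : ℕ) :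
    ∑ i ∈ Finset.range n, y i =
      -- The `+ 0` gives long blocks and gaps the common shape `j * L + d + i`.
      ∑ j ∈ Finset.range (n / (m + 2)), ∑ i ∈ Finset.range m, y (j * (m + 2) + 0 + i) +
      ∑ j ∈ Finset.range (n / (m + 2)), ∑ i ∈ Finset.range 2, y (j * (m + 2) + m + i) +
      ∑ i ∈ Finset.range (n % (m + 2)), y (n / (m + 2) * (m + 2) + i) := by
  have h1 : ∀ q, ∑ i ∈ Finset.range (q * (m + 2)), y i =
      ∑ j ∈ Finset.range q, ∑ i ∈ Finset.range m, y (j * (m + 2) + 0 + i) +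
      ∑ j ∈ Finset.range q, ∑ i ∈ Finset.range 2, y (j * (m + 2) + m + i) := by
    intro q
    induction q with
    | zero => simp
    | succ q ih =>
      rw [Nat.succ_mul, Finset.sum_range_add, ih,
        Finset.sum_range_add (fun i => y (q * (m + 2) + i)) m 2,
        Finset.sum_range_succ (fun j => ∑ i ∈ Finset.range m, y (j * (m + 2) + 0 + i)),
        Finset.sum_range_succ (fun j => ∑ i ∈ Finset.range 2, y (j * (m + 2) + m + i))]
      simp only [add_zero, ← add_assoc]
      ring
  rw [← h1, ← Finset.sum_range_add, Nat.div_add_mod']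

end Blocks

/-! ### Central limit theorem for i.i.d. sequences -/

section Clt

variable {ν : Measure ℝ} [IsProbabilityMeasure ν]

open scoped Topology

theorem tendsto_sqrt_div_div_sqrt (L : ℕ) :
    Tendsto (fun n : ℕ => √((n / L : ℕ) : ℝ) / √(n : ℝ)) atTop (𝓝 √(1 / (L : ℝ))) := by
  have h := (tendsto_nat_floor_mul_div_atTop (R := ℝ) (a := 1 / (L : ℝ)) (by positivity)).comp
    tendsto_natCast_atTop_atTop
  have h2 := h.sqrt
  refine h2.congr fun n => ?_
  simp only [Function.comp]
  rw [← Real.sqrt_div (by positivity), one_div_mul_eq_div, Nat.floor_div_eq_div]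

theorem integral_abs_sum_blocks_le [NullSingletonClass ν] {m L : ℕ} (h : m + 4 ≤ L) (d : ℕ)
    {q : ℕ} (hq : 0 < q) :
    ∫ ω, |∑ j ∈ Finset.range q, ∑ i ∈ Finset.range (m + 2), centredTurn (j * L + d + i) ω|
      ∂(Measure.infinitePi fun _ : ℕ => ν) ≤ √q * (1 + m) := by
  have hq' : (0 : ℝ) < q := by exact_mod_cast hq
  have hs : 0 < √(q : ℝ) := Real.sqrt_pos.2 hq'
  have h1 := integral_abs_le_of_sq (μ := Measure.infinitePi fun _ : ℕ => ν)
    (memLp_finsetSum (Finset.range q) fun j _ =>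
      memLp_sum_centredTurn (ν := ν) (m + 2) (j * L + d) 2) hs
  rw [integral_sum_blocks_sq h] at h1
  refine h1.trans ?_
  have h2 : (q : ℝ) * (7 / 18 + 8 / 45 * m) / √q = √q * (7 / 18 + 8 / 45 * m) := by
    rw [mul_comm, mul_div_assoc, Real.div_sqrt, mul_comm]
  rw [h2]
  nlinarith [mul_nonneg hs.le (Nat.cast_nonneg (α := ℝ) m)]

/-- The three error terms come from the gaps (themselves independent blocks of length two, hence of
size `√q`), from the remainder of fewer than `p + 4` terms, and from replacing `√(q / n)` by `√(1 /
(p + 4))`. -/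
theorem integral_abs_sum_sub_blocks_le [NullSingletonClass ν] (p : ℕ) {n : ℕ} (hn : p + 4 ≤ n) :
    ∫ ω, |(√n)⁻¹ * ∑ i ∈ Finset.range n, centredTurn i ω -
        (√((p + 4 : ℕ) : ℝ))⁻¹ * ((√((n / (p + 4) : ℕ) : ℝ))⁻¹ *
          ∑ j ∈ Finset.range (n / (p + 4)), ∑ i ∈ Finset.range (p + 2),
            centredTurn (j * (p + 4) + 0 + i) ω)|
      ∂(Measure.infinitePi fun _ : ℕ => ν) ≤
    √((n / (p + 4) : ℕ) : ℝ) / √n + (p + 4) / √n +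
      |√((n / (p + 4) : ℕ) : ℝ) / √n - √(1 / ((p + 4 : ℕ) : ℝ))| * (1 + p) := by
  set q := n / (p + 4) with hqdef
  have hq : 0 < q := Nat.div_pos hn (by omega)
  have hq' : (0 : ℝ) < q := by exact_mod_cast hq
  have hs : 0 < √(q : ℝ) := Real.sqrt_pos.2 hq'
  have hn' : (0 : ℝ) < n := by exact_mod_cast (by omega : 0 < n)
  have hsn : 0 < √(n : ℝ) := Real.sqrt_pos.2 hn'
  have hL : (0 : ℝ) < √((p + 4 : ℕ) : ℝ) := Real.sqrt_pos.2 (by positivity)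
  set Z : (ℕ → ℝ) → ℝ := fun ω => ∑ j ∈ Finset.range q, ∑ i ∈ Finset.range (p + 2),
    centredTurn (j * (p + 4) + 0 + i) ω with hZ
  set W : (ℕ → ℝ) → ℝ := fun ω => ∑ j ∈ Finset.range q, ∑ i ∈ Finset.range 2,
    centredTurn (j * (p + 4) + (p + 2) + i) ω with hW
  have hZm : MemLp Z 1 (Measure.infinitePi fun _ : ℕ => ν) := memLp_finsetSum _ fun j _ =>
    memLp_sum_centredTurn _ _ 1
  have hWm : MemLp W 1 (Measure.infinitePi fun _ : ℕ => ν) := memLp_finsetSum _ fun j _ =>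
    memLp_sum_centredTurn _ _ 1
  have hZi := integral_abs_sum_blocks_le (ν := ν) (m := p) (L := p + 4) le_rfl 0 hq
  have hWi := integral_abs_sum_blocks_le (ν := ν) (m := 0) (L := p + 4) (by omega) (p + 2) hq
  rw [Nat.cast_zero, add_zero, mul_one, zero_add] at hWi
  have hpt : ∀ ω, |(√n)⁻¹ * ∑ i ∈ Finset.range n, centredTurn i ω -
        (√((p + 4 : ℕ) : ℝ))⁻¹ * ((√(q : ℝ))⁻¹ * Z ω)| ≤
      (√n)⁻¹ * |W ω| + (p + 4) / √n +
        |√q / √n - √(1 / ((p + 4 : ℕ) : ℝ))| / √q * |Z ω| := by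
    intro ω
    have h1 := sum_range_eq_sum_blocks (fun i => centredTurn i ω) (p + 2) n
    have h2 : |∑ i ∈ Finset.range (n % (p + 4)), centredTurn (q * (p + 4) + i) ω| ≤ p + 4 := by
      refine (Finset.abs_sum_le_sum_abs _ _).trans
        ((Finset.sum_le_sum fun i _ => abs_centredTurn_le _ _).trans ?_)
      rw [Finset.sum_const, Finset.card_range, nsmul_eq_mul, mul_one]
      exact_mod_cast (Nat.mod_lt n (by omega : 0 < p + 4)).le
    set R := ∑ i ∈ Finset.range (n % (p + 4)), centredTurn (q * (p + 4) + i) ω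
    have h3 : ∑ i ∈ Finset.range n, centredTurn i ω = Z ω + W ω + R := h1
    have h4 : (√n)⁻¹ * ∑ i ∈ Finset.range n, centredTurn i ω -
        (√((p + 4 : ℕ) : ℝ))⁻¹ * ((√(q : ℝ))⁻¹ * Z ω) =
        (√n)⁻¹ * W ω + (√n)⁻¹ * R + (√q / √n - √(1 / ((p + 4 : ℕ) : ℝ))) / √q * Z ω := by
      rw [h3, one_div, Real.sqrt_inv]
      field_simp
      ring
    rw [h4]
    refine (abs_add_three _ _ _).trans ?_
    rw [abs_mul, abs_mul, abs_mul, abs_div, abs_of_pos hs, abs_of_pos (inv_pos.2 hsn)]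
    gcongr
    rw [div_eq_inv_mul]
    gcongr
  have hint1 : Integrable (fun ω => (√n)⁻¹ * |W ω|) (Measure.infinitePi fun _ : ℕ => ν) :=
    (hWm.integrable le_rfl).abs.const_mul _
  have hint2 : Integrable (fun ω => |√q / √n - √(1 / ((p + 4 : ℕ) : ℝ))| / √q * |Z ω|)
      (Measure.infinitePi fun _ : ℕ => ν) := (hZm.integrable le_rfl).abs.const_mul _
  refine (integral_mono_of_nonneg (Eventually.of_forall fun ω => abs_nonneg _)
    ((hint1.fun_add (integrable_const _)).fun_add hint2) (Eventually.of_forall hpt)).trans ?_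
  rw [integral_add (hint1.fun_add (integrable_const _)) hint2,
    integral_add hint1 (integrable_const _), integral_const_mul, integral_const_mul, integral_const,
    probReal_univ, one_smul]
  refine add_le_add (add_le_add ?_ le_rfl) ?_
  · rw [div_eq_inv_mul]
    exact mul_le_mul_of_nonneg_left hWi (inv_nonneg.2 hsn.le)
  · calc |√q / √n - √(1 / ((p + 4 : ℕ) : ℝ))| / √q * ∫ ω, |Z ω| ∂(Measure.infinitePi fun _ => ν)
        ≤ |√q / √n - √(1 / ((p + 4 : ℕ) : ℝ))| / √q * (√q * (1 + p)) := by gcongr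
      _ = _ := by field_simp

/-- The central limit theorem for the number of local extrema of a random sequence. -/
theorem tendsto_charFun_sum_centredTurn [NullSingletonClass ν] (t : ℝ) :
    Tendsto (fun n : ℕ => charFun ((Measure.infinitePi fun _ : ℕ => ν).map fun ω =>
      (√n)⁻¹ * ∑ i ∈ Finset.range n, centredTurn i ω) t) atTop
      (𝓝 (Complex.exp (-((8 / 45 : ℝ) * t ^ 2 / 2)))) := by
  have hcast : Tendsto (fun p : ℕ => ((p + 4 : ℕ) : ℝ)) atTop atTop :=
    tendsto_natCast_atTop_atTop.comp (tendsto_add_atTop_nat 4)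
  have hsum : ∀ n : ℕ, Measurable fun ω => (√n)⁻¹ * ∑ i ∈ Finset.range n, centredTurn i ω := fun n =>
    (Finset.measurable_fun_sum _ fun i _ => measurable_centredTurn i).const_mul _
  have hblock : ∀ p q : ℕ, Measurable fun ω => (√q)⁻¹ *
      ∑ j ∈ Finset.range q, ∑ i ∈ Finset.range (p + 2), centredTurn (j * (p + 4) + 0 + i) ω :=
    fun p q => (Finset.measurable_fun_sum _ fun j _ => Finset.measurable_fun_sum _ fun i _ =>
      measurable_centredTurn _).const_mul _
  -- With period `p + 4` the normalised block sum is taken at `t / √(p + 4)`, since `√n` is close to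
  -- `√(p + 4) * √(n / (p + 4))`.
  refine tendsto_of_tendsto_of_norm_sub_le
    (b := fun p n => charFun ((Measure.infinitePi fun _ : ℕ => ν).map fun ω =>
      (√((n / (p + 4) : ℕ) : ℝ))⁻¹ * ∑ j ∈ Finset.range (n / (p + 4)),
        ∑ i ∈ Finset.range (p + 2), centredTurn (j * (p + 4) + 0 + i) ω)
      ((√((p + 4 : ℕ) : ℝ))⁻¹ * t))
    (c := fun p => Complex.exp (-((7 / 18 + 8 / 45 * p : ℝ) *
      (((√((p + 4 : ℕ) : ℝ))⁻¹ * t : ℝ) : ℂ) ^ 2 / 2)))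
    (δ := fun p n => |t| * (√((n / (p + 4) : ℕ) : ℝ) / √n + (p + 4) / √n +
      |√((n / (p + 4) : ℕ) : ℝ) / √n - √(1 / ((p + 4 : ℕ) : ℝ))| * (1 + p)))
    (d := fun p => |t| * (√(1 / ((p + 4 : ℕ) : ℝ)) + 0 + |√(1 / ((p + 4 : ℕ) : ℝ)) -
      √(1 / ((p + 4 : ℕ) : ℝ))| * (1 + p))) ?_ ?_ ?_ ?_ ?_
  · refine Eventually.of_forall fun p => ?_
    have h := tendsto_charFun_of_iIndepFun (μ := Measure.infinitePi fun _ : ℕ => ν)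
      (memLp_sum_centredTurn (p + 2) (0 * (p + 4) + 0) 2)
      (iIndepFun_sum_centredTurn (m := p + 2) (L := p + 4) le_rfl 0)
      (fun j => identDistrib_sum_centredTurn_shift _ _ _) (integral_sum_centredTurn _ _)
      ((√((p + 4 : ℕ) : ℝ))⁻¹ * t)
    rw [integral_sum_centredTurn_sq] at h
    exact h.comp (Nat.tendsto_div_const_atTop (by omega))
  · refine Eventually.of_forall fun p => ?_
    filter_upwards [eventually_ge_atTop (p + 4)] with n hn
    rw [← charFun_map_mul_comp (hblock p _).aemeasurable]
    refine (norm_charFun_map_sub_le (hsum n).aemeasurable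
      ((hblock p _).const_mul _).aemeasurable ?_ t).trans
      (mul_le_mul_of_nonneg_left (integral_abs_sum_sub_blocks_le p hn) (abs_nonneg t))
    refine Integrable.sub ?_ ?_
    · exact (integrable_finsetSum _ fun i _ =>
        (memLp_centredTurn i 1).integrable le_rfl).const_mul _
    · exact ((integrable_finsetSum _ fun j _ =>
        (memLp_sum_centredTurn _ _ 1).integrable le_rfl).const_mul _).const_mul _
  · refine Eventually.of_forall fun p => ?_
    have h1 := tendsto_sqrt_div_div_sqrt (p + 4)
    have h2 : Tendsto (fun n : ℕ => ((p : ℝ) + 4) / √(n : ℝ)) atTop (𝓝 0) :=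
      (Real.tendsto_sqrt_atTop.comp tendsto_natCast_atTop_atTop).const_div_atTop _
    exact ((h1.add h2).add ((h1.sub_const _).abs.mul_const _)).const_mul _
  · have h1 : Tendsto (fun p : ℕ => √(1 / ((p + 4 : ℕ) : ℝ))) atTop (𝓝 0) := by
      have := (hcast.const_div_atTop 1).sqrt
      rwa [Real.sqrt_zero] at this
    simpa using h1.const_mul |t|
  · have h1 : Tendsto (fun p : ℕ => (7 / 18 + 8 / 45 * p : ℝ) * ((√((p + 4 : ℕ) : ℝ))⁻¹ * t) ^ 2 / 2)
        atTop (𝓝 (8 / 45 * t ^ 2 / 2)) := by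
      -- The block variance per period is `(7/18 + 8/45 p) / (p + 4) = 8/45 - (29/90) / (p + 4)`.
      have h2 : Tendsto (fun p : ℕ => (8 / 45 - (29 / 90) / ((p + 4 : ℕ) : ℝ)) * t ^ 2 / 2) atTop
          (𝓝 ((8 / 45 - 0) * t ^ 2 / 2)) :=
        (((hcast.const_div_atTop _).const_sub _).mul_const _).div_const _
      rw [sub_zero] at h2
      refine h2.congr fun p => ?_
      rw [mul_pow, inv_pow, Real.sq_sqrt (by positivity)]
      push_cast
      have : (p : ℝ) + 4 ≠ 0 := by positivity
      field_simp
      ring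
    have h3 := (Complex.continuous_exp.comp Complex.continuous_ofReal).tendsto
      (-(8 / 45 * t ^ 2 / 2)) |>.comp h1.neg
    convert! h3 using 2
    · simp only [Function.comp]
      push_cast
      rfl
    · simp

end Clt

/-! ### Stability of the standardised limit -/

section Standardize

open scoped Topology

/-- With `A - E A = T + Y`, the integrand difference is `2 T Y + Y²`, and `2 |T Y| ≤ T² / s + s Y²`.
Taking `s = √n` later makes the error `o(n)`. -/
theorem abs_variance_sub_le {Ω : Type*} {mΩ : MeasurableSpace Ω} {μ : Measure Ω}
    [IsProbabilityMeasure μ] {A T : Ω → ℝ} (hA : MemLp A 2 μ) (hT : MemLp T 2 μ)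
    (hT0 : ∫ ω, T ω ∂μ = 0) {s : ℝ} (hs : 0 < s) :
    |Var[A; μ] - ∫ ω, T ω ^ 2 ∂μ| ≤
      (∫ ω, T ω ^ 2 ∂μ) / s + (s + 1) * Var[fun ω => A ω - T ω; μ] := by
  have hAT : MemLp (fun ω => A ω - T ω) 2 μ := hA.sub hT
  have hm : ∫ ω, A ω - T ω ∂μ = ∫ ω, A ω ∂μ := by
    rw [integral_sub (hA.integrable (by norm_num)) (hT.integrable (by norm_num)), hT0, sub_zero]
  rw [variance_eq_integral hA.aemeasurable, variance_eq_integral hAT.aemeasurable, hm]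
  set a := ∫ ω, A ω ∂μ
  have hi1 : Integrable (fun ω => (A ω - a) ^ 2) μ := (hA.sub (memLp_const a)).integrable_sq
  have hi2 : Integrable (fun ω => T ω ^ 2) μ := hT.integrable_sq
  have hi3 : Integrable (fun ω => (A ω - T ω - a) ^ 2) μ := (hAT.sub (memLp_const a)).integrable_sq
  rw [← integral_sub hi1 hi2, ← integral_div, ← integral_const_mul,
    ← integral_add (hi2.div_const s) (hi3.const_mul _)]
  refine (abs_integral_le_integral_abs).trans (integral_mono (hi1.sub hi2).abs
    ((hi2.div_const s).add (hi3.const_mul _)) fun ω => ?_)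
  simp only
  set x := T ω
  set y := A ω - x - a with hy
  have e : A ω - a = x + y := by rw [hy]; ring
  rw [e]
  have h1 : 0 ≤ (x - s * y) ^ 2 / s := by positivity
  have h2 : 0 ≤ (x + s * y) ^ 2 / s := by positivity
  have h3 : (x - s * y) ^ 2 / s = x ^ 2 / s - 2 * (x * y) + s * y ^ 2 := by
    field_simp
    ring
  have h4 : (x + s * y) ^ 2 / s = x ^ 2 / s + 2 * (x * y) + s * y ^ 2 := by
    field_simp
    ring
  rw [abs_le]
  constructor <;> nlinarith [sq_nonneg y]

/-- The difference splits into `(A - T - E A) / r` and `(T / s) (s / r - u)`;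
`integral_abs_le_of_sq` bounds them with `c = 1` and `c = s`. -/
theorem integral_abs_standardize_sub_le {Ω : Type*} {mΩ : MeasurableSpace Ω} {μ : Measure Ω}
    [IsProbabilityMeasure μ] {A T : Ω → ℝ} (hA : MemLp A 2 μ) (hT : MemLp T 2 μ)
    (hT0 : ∫ ω, T ω ∂μ = 0) {s r u : ℝ} (hs : 0 < s) :
    ∫ ω, |(A ω - ∫ τ, A τ ∂μ) / r - u * (s⁻¹ * T ω)| ∂μ ≤
      (1 + Var[fun ω => A ω - T ω; μ]) / 2 * |r⁻¹| +
        (1 + (∫ ω, T ω ^ 2 ∂μ) / s ^ 2) / 2 * |s / r - u| := by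
  have hAT : MemLp (fun ω => A ω - T ω) 2 μ := hA.sub hT
  have hm : ∫ ω, A ω - T ω ∂μ = ∫ ω, A ω ∂μ := by
    rw [integral_sub (hA.integrable (by norm_num)) (hT.integrable (by norm_num)), hT0, sub_zero]
  rw [variance_eq_integral hAT.aemeasurable, hm]
  set a := ∫ ω, A ω ∂μ
  have hR : MemLp (fun ω => A ω - T ω - a) 2 μ := hAT.sub (memLp_const a)
  have h1 := integral_abs_le_of_sq hR one_pos
  have h2 := integral_abs_le_of_sq hT hs
  have hi1 : Integrable (fun ω => |A ω - T ω - a|) μ := (hR.integrable (by norm_num)).abs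
  have hi2 : Integrable (fun ω => |T ω|) μ := (hT.integrable (by norm_num)).abs
  have h3 : ∫ ω, |(A ω - a) / r - u * (s⁻¹ * T ω)| ∂μ ≤
      ∫ ω, (|A ω - T ω - a| * |r⁻¹| + |T ω| * (|s / r - u| / s)) ∂μ := by
    refine integral_mono_of_nonneg (Eventually.of_forall fun ω => abs_nonneg _)
      ((hi1.mul_const _).add (hi2.mul_const _)) (Eventually.of_forall fun ω => ?_)
    have e : (A ω - a) / r - u * (s⁻¹ * T ω) =
        (A ω - T ω - a) * r⁻¹ + T ω * ((s / r - u) / s) := by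
      -- Since `r` may vanish, it enters only through `r⁻¹`.
      rw [div_eq_mul_inv _ r, div_eq_mul_inv s r]
      field_simp
      ring
    simp only
    rw [e]
    refine (abs_add_le _ _).trans ?_
    rw [abs_mul, abs_mul, abs_div, abs_of_pos hs]
  refine h3.trans ?_
  rw [integral_add (hi1.mul_const _) (hi2.mul_const _), integral_mul_const, integral_mul_const]
  refine add_le_add (mul_le_mul_of_nonneg_right (by simpa using h1) (abs_nonneg _)) ?_
  refine (mul_le_mul_of_nonneg_right h2 (by positivity)).trans (le_of_eq ?_)
  field_simp

/-- Perturbing a centred sequence satisfying the central limit theorem by terms of bounded second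
moment and by constants does not change the limit of the standardized sequence. -/
theorem tendsto_charFun_standardize {Ω : ℕ → Type*} {mΩ : ∀ n, MeasurableSpace (Ω n)}
    {μ : ∀ n, Measure (Ω n)} [∀ n, IsProbabilityMeasure (μ n)] {A T : ∀ n, Ω n → ℝ}
    {c : ℕ → ℝ} {v C : ℝ} (hv : 0 < v) (hA : ∀ n, MemLp (A n) 2 (μ n))
    (hT : ∀ n, MemLp (T n) 2 (μ n)) (hT0 : ∀ n, ∫ ω, T n ω ∂(μ n) = 0)
    (hT2 : Tendsto (fun n : ℕ => (∫ ω, T n ω ^ 2 ∂(μ n)) / n) atTop (𝓝 v))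
    (hR : ∀ᶠ n in atTop, ∫ ω, (A n ω - T n ω - c n) ^ 2 ∂(μ n) ≤ C)
    (hclt : ∀ t : ℝ, Tendsto (fun n : ℕ => charFun ((μ n).map fun ω => (√n)⁻¹ * T n ω) t) atTop
      (𝓝 (Complex.exp (-(v * t ^ 2 / 2))))) (t : ℝ) :
    Tendsto (fun n => charFun ((μ n).map fun ω =>
      (A n ω - ∫ τ, A n τ ∂(μ n)) / √(Var[A n; μ n])) t) atTop (𝓝 (Complex.exp (-(t ^ 2 / 2)))) := by
  have hAT : ∀ n, MemLp (fun ω => A n ω - T n ω) 2 (μ n) := fun n => (hA n).sub (hT n)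
  have hV : ∀ᶠ n in atTop, Var[fun ω => A n ω - T n ω; μ n] ≤ C := by
    filter_upwards [hR] with n hn
    -- Shifting by `c n` leaves the variance unchanged, so any second moment about a constant bounds
    -- it.
    have h1 := variance_sub_const (hAT n).aestronglyMeasurable (c n)
    rw [← h1]
    refine (variance_le_expectation_sq ?_).trans hn
    exact ((hAT n).sub (memLp_const _)).aestronglyMeasurable
  have hsqrt : Tendsto (fun n : ℕ => √(n : ℝ)) atTop atTop :=
    Real.tendsto_sqrt_atTop.comp tendsto_natCast_atTop_atTop
  have hw : Tendsto (fun n : ℕ => Var[A n; μ n] / n) atTop (𝓝 v) := by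
    have h1 : Tendsto (fun n : ℕ => Var[A n; μ n] / n - (∫ ω, T n ω ^ 2 ∂(μ n)) / n) atTop
        (𝓝 0) := by
      have h2 : Tendsto (fun n : ℕ => (∫ ω, T n ω ^ 2 ∂(μ n)) / n * (1 / √(n : ℝ)) +
          (C * (1 / √(n : ℝ)) + C / n)) atTop (𝓝 (v * 0 + (C * 0 + 0))) :=
        (hT2.mul (hsqrt.const_div_atTop 1)).add (((hsqrt.const_div_atTop 1).const_mul C).add
          (tendsto_natCast_atTop_atTop.const_div_atTop C))
      rw [mul_zero, mul_zero, add_zero, add_zero] at h2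
      refine squeeze_zero_norm' ?_ h2
      filter_upwards [hV, eventually_ge_atTop 1] with n hn hn1
      have hn' : (0 : ℝ) < n := by exact_mod_cast hn1
      have hs : 0 < √(n : ℝ) := Real.sqrt_pos.2 hn'
      have h3 := abs_variance_sub_le (hA n) (hT n) (hT0 n) hs
      rw [← sub_div, Real.norm_eq_abs, abs_div, abs_of_pos hn', div_le_iff₀ hn']
      refine h3.trans ?_
      have h4 : (√(n : ℝ) + 1) * Var[fun ω => A n ω - T n ω; μ n] ≤ (√(n : ℝ) + 1) * C := by
        gcongr
      refine (add_le_add le_rfl h4).trans (le_of_eq ?_)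
      have h5 : (n : ℝ) = √(n : ℝ) * √(n : ℝ) := (Real.mul_self_sqrt hn'.le).symm
      field_simp
      linear_combination (-C) * h5
    simpa using h1.add hT2
  have hwpos : ∀ᶠ n : ℕ in atTop, 0 < Var[A n; μ n] / n := hw.eventually_const_lt hv
  have hsv : 0 < √v := Real.sqrt_pos.2 hv
  have hratio : Tendsto (fun n : ℕ => √(n : ℝ) / √(Var[A n; μ n])) atTop (𝓝 (√v)⁻¹) := by
    refine (hw.sqrt.inv₀ hsv.ne').congr fun n => ?_
    rw [Real.sqrt_div (variance_nonneg _ _), inv_div]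
  have hinv : Tendsto (fun n : ℕ => (√(Var[A n; μ n]))⁻¹) atTop (𝓝 0) := by
    have h1 := hratio.mul (hsqrt.const_div_atTop 1)
    rw [mul_zero] at h1
    refine h1.congr' ?_
    filter_upwards [eventually_ge_atTop 1] with n hn1
    have hs : 0 < √(n : ℝ) := Real.sqrt_pos.2 (by exact_mod_cast hn1)
    field_simp
  have hlim : Tendsto (fun n : ℕ => charFun ((μ n).map fun ω => (√v)⁻¹ * ((√n)⁻¹ * T n ω)) t) atTop
      (𝓝 (Complex.exp (-(t ^ 2 / 2)))) := by
    have h1 := hclt ((√v)⁻¹ * t)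
    have e : (v : ℂ) * (((√v)⁻¹ * t : ℝ) : ℂ) ^ 2 = (t : ℂ) ^ 2 := by
      have : v * ((√v)⁻¹ * t) ^ 2 = t ^ 2 := by
        rw [mul_pow, inv_pow, Real.sq_sqrt hv.le]; field_simp
      exact_mod_cast this
    rw [e] at h1
    refine h1.congr fun n => ?_
    rw [charFun_map_mul_comp ((hT n).aemeasurable.const_mul _)]
  have hbound : Tendsto (fun n : ℕ => |t| * ((1 + C) / 2 * |(√(Var[A n; μ n]))⁻¹| +
      (1 + (∫ ω, T n ω ^ 2 ∂(μ n)) / n) / 2 * |√n / √(Var[A n; μ n]) - (√v)⁻¹|)) atTop (𝓝 0) := by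
    have h1 := ((hinv.abs.const_mul ((1 + C) / 2)).add
      (((hT2.const_add 1).div_const 2).mul (hratio.sub_const (√v)⁻¹).abs)).const_mul |t|
    simpa using h1
  have hdiff : Tendsto (fun n => charFun ((μ n).map fun ω =>
      (A n ω - ∫ τ, A n τ ∂(μ n)) / √(Var[A n; μ n])) t -
      charFun ((μ n).map fun ω => (√v)⁻¹ * ((√n)⁻¹ * T n ω)) t) atTop (𝓝 0) := by
    refine squeeze_zero_norm' ?_ hbound
    filter_upwards [hV, eventually_ge_atTop 1] with n hn hn1
    have hn' : (0 : ℝ) < n := by exact_mod_cast hn1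
    have hs : 0 < √(n : ℝ) := Real.sqrt_pos.2 hn'
    have hZ : MemLp (fun ω => (A n ω - ∫ τ, A n τ ∂(μ n)) / √(Var[A n; μ n])) 1 (μ n) := by
      simp_rw [div_eq_inv_mul]
      exact (((hA n).sub (memLp_const _)).const_mul _).mono_exponent (by norm_num)
    have hW : MemLp (fun ω => (√v)⁻¹ * ((√n)⁻¹ * T n ω)) 1 (μ n) :=
      (((hT n).const_mul _).const_mul _).mono_exponent (by norm_num)
    refine (norm_charFun_map_sub_le hZ.aemeasurable hW.aemeasurable
      ((hZ.integrable le_rfl).sub (hW.integrable le_rfl)) t).trans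
      (mul_le_mul_of_nonneg_left ?_ (abs_nonneg t))
    refine (integral_abs_standardize_sub_le (hA n) (hT n) (hT0 n) hs).trans ?_
    rw [Real.sq_sqrt hn'.le]
    gcongr
  simpa using hdiff.add hlim

end Standardize

/-! ### Conclusion for random permutations -/

section Permutations

open scoped Topology

/-- The centred number of interior local extrema of a permutation. -/
noncomputable def centredExtrema (n : ℕ) (σ : Equiv.Perm (Fin n)) : ℝ :=
  ∑ i ∈ Finset.range (n - 2),
    (turn (permSeq σ i) (permSeq σ (i + 1)) (permSeq σ (i + 2)) - 2 / 3)

theorem identDistrib_centredExtrema {ν : Measure ℝ} [IsProbabilityMeasure ν]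
    [NullSingletonClass ν] (m : ℕ) :
    IdentDistrib (fun ω : ℕ → ℝ => ∑ i ∈ Finset.range m, centredTurn i ω) (centredExtrema (m + 2))
      (Measure.infinitePi fun _ : ℕ => ν) (uniformPerm (m + 2)) := by
  have h := identDistrib_sum_centredTurn (ν := ν) m 0
  simp only [zero_add] at h
  exact h

/-- The Gaussian serves merely as one atomless law for the auxiliary sequence. -/
theorem nullSingletonClass_gaussianReal_one : NullSingletonClass (gaussianReal 0 1) :=
  nullSingletonClass_gaussianReal one_ne_zero

theorem integral_centredExtrema (n : ℕ) : ∫ σ, centredExtrema n σ ∂(uniformPerm n) = 0 := by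
  have := nullSingletonClass_gaussianReal_one
  rcases n with _ | _ | m
  · simp [centredExtrema]
  · simp [centredExtrema]
  · rw [← (identDistrib_centredExtrema (ν := gaussianReal 0 1) m).integral_eq]
    simpa only [zero_add] using integral_sum_centredTurn (ν := gaussianReal 0 1) m 0

theorem integral_centredExtrema_sq (p : ℕ) :
    ∫ σ, centredExtrema (p + 4) σ ^ 2 ∂(uniformPerm (p + 4)) = 7 / 18 + 8 / 45 * p := by
  have := nullSingletonClass_gaussianReal_one
  rw [← (identDistrib_centredExtrema (ν := gaussianReal 0 1) (p + 2)).sq.integral_eq]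
  simpa only [zero_add] using integral_sum_centredTurn_sq (ν := gaussianReal 0 1) p 0

theorem tendsto_integral_centredExtrema_sq_div :
    Tendsto (fun n : ℕ => (∫ σ, centredExtrema n σ ^ 2 ∂(uniformPerm n)) / n) atTop
      (𝓝 (8 / 45)) := by
  rw [← tendsto_add_atTop_iff_nat 4]
  have hcast : Tendsto (fun p : ℕ => ((p + 4 : ℕ) : ℝ)) atTop atTop :=
    tendsto_natCast_atTop_atTop.comp (tendsto_add_atTop_nat 4)
  have h : Tendsto (fun p : ℕ => 8 / 45 - (29 / 90) / ((p + 4 : ℕ) : ℝ)) atTop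
      (𝓝 (8 / 45 - 0)) := (hcast.const_div_atTop _).const_sub _
  rw [sub_zero] at h
  refine h.congr fun p => ?_
  rw [integral_centredExtrema_sq]
  push_cast
  field_simp
  ring

/-- A permutation of `n` letters has `n - 2` interior positions; the two summands missing from the
i.i.d. sum contribute at most `2 / √n`. -/
theorem tendsto_charFun_centredExtrema (t : ℝ) :
    Tendsto (fun n : ℕ => charFun ((uniformPerm n).map fun σ => (√n)⁻¹ * centredExtrema n σ) t)
      atTop (𝓝 (Complex.exp (-((8 / 45 : ℝ) * t ^ 2 / 2)))) := by
  have := nullSingletonClass_gaussianReal_one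
  rw [← tendsto_add_atTop_iff_nat 2]
  have h1 := (tendsto_add_atTop_iff_nat 2).2
    (tendsto_charFun_sum_centredTurn (ν := gaussianReal 0 1) t)
  have hbound : Tendsto (fun m : ℕ => |t| * (2 / √((m + 2 : ℕ) : ℝ))) atTop (𝓝 0) := by
    have := ((Real.tendsto_sqrt_atTop.comp (tendsto_natCast_atTop_atTop.comp
      (tendsto_add_atTop_nat 2))).const_div_atTop (2 : ℝ)).const_mul |t|
    rwa [mul_zero] at this
  have hmeas : ∀ (s : ℝ) (m : ℕ), Measurable fun ω : ℕ → ℝ =>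
      s * ∑ i ∈ Finset.range m, centredTurn i ω := fun s m =>
    (Finset.measurable_fun_sum _ fun i _ => measurable_centredTurn i).const_mul _
  have hint : ∀ (s : ℝ) (m : ℕ), Integrable (fun ω : ℕ → ℝ =>
      s * ∑ i ∈ Finset.range m, centredTurn i ω)
      (Measure.infinitePi fun _ : ℕ => gaussianReal 0 1) := fun s m =>
    (integrable_finsetSum _ fun i _ => (memLp_centredTurn i 1).integrable le_rfl).const_mul _
  have hdiff : Tendsto (fun m : ℕ =>
      charFun ((uniformPerm (m + 2)).map fun σ =>
        (√((m + 2 : ℕ) : ℝ))⁻¹ * centredExtrema (m + 2) σ) t -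
      charFun ((Measure.infinitePi fun _ : ℕ => gaussianReal 0 1).map fun ω =>
        (√((m + 2 : ℕ) : ℝ))⁻¹ * ∑ i ∈ Finset.range (m + 2), centredTurn i ω) t) atTop (𝓝 0) := by
    refine squeeze_zero_norm (fun m => ?_) hbound
    rw [← ((identDistrib_centredExtrema (ν := gaussianReal 0 1) m).const_mul _).map_eq]
    refine (norm_charFun_map_sub_le (hmeas _ _).aemeasurable (hmeas _ _).aemeasurable
      ((hint _ _).sub (hint _ _)) t).trans (mul_le_mul_of_nonneg_left ?_ (abs_nonneg t))
    have h2 : ∀ ω : ℕ → ℝ, |(√((m + 2 : ℕ) : ℝ))⁻¹ * ∑ i ∈ Finset.range m, centredTurn i ω -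
        (√((m + 2 : ℕ) : ℝ))⁻¹ * ∑ i ∈ Finset.range (m + 2), centredTurn i ω| ≤
        2 / √((m + 2 : ℕ) : ℝ) := by
      intro ω
      rw [← mul_sub, abs_mul, abs_inv, abs_of_nonneg (Real.sqrt_nonneg _), div_eq_inv_mul]
      refine mul_le_mul_of_nonneg_left ?_ (inv_nonneg.2 (Real.sqrt_nonneg _))
      rw [Finset.sum_range_succ, Finset.sum_range_succ]
      have h3 := abs_le.1 (abs_centredTurn_le m ω)
      have h4 := abs_le.1 (abs_centredTurn_le (m + 1) ω)
      rw [abs_le]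
      constructor <;> linarith [h3.1, h3.2, h4.1, h4.2]
    refine (integral_mono ((hint _ _).sub (hint _ _)).abs (integrable_const _) h2).trans ?_
    simp
  simpa using hdiff.add h1

theorem integral_asRV_sub_centredExtrema_sq_le {k : ℕ} (hk : 1 ≤ k) {n : ℕ} (hn : 4 ≤ n) :
    ∫ σ, (asRV n k σ - centredExtrema n σ - 2 / 3 * ((n : ℝ) - 2)) ^ 2 ∂(uniformPerm n) ≤
      (8 + 8 * ((3 + 6 * k) * (2 * k)) : ℝ) := by
  obtain ⟨m, rfl⟩ : ∃ m, n = m + 2 := ⟨n - 2, by omega⟩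
  have h1 := integral_smallSteps_sq_le k (n := m + 1) (by omega)
  have hi : Integrable (fun σ => (smallSteps k (permSeq σ) (m + 1) : ℝ) ^ 2)
    (uniformPerm (m + 2)) := .of_finite
  have h2 : ∫ σ, (asRV (m + 2) k σ - centredExtrema (m + 2) σ -
      2 / 3 * (((m + 2 : ℕ) : ℝ) - 2)) ^ 2 ∂(uniformPerm (m + 2)) ≤
      ∫ σ, (8 + 8 * (smallSteps k (permSeq σ) (m + 1) : ℝ) ^ 2) ∂(uniformPerm (m + 2)) := by
    refine integral_mono .of_finite .of_finite fun σ => ?_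
    have h3 := abs_longestKAlternating_sub_sum_turn_le hk σ
    have h4 : asRV (m + 2) k σ - centredExtrema (m + 2) σ - 2 / 3 * (((m + 2 : ℕ) : ℝ) - 2) =
        (longestKAlternating k σ : ℝ) - ∑ i ∈ Finset.range m,
          turn (permSeq σ i) (permSeq σ (i + 1)) (permSeq σ (i + 2)) := by
      rw [asRV, centredExtrema, Finset.sum_sub_distrib]
      simp
      ring
    simp only
    rw [h4]
    set B : ℝ := (smallSteps k (permSeq σ) (m + 1) : ℝ)
    have h5 := pow_le_pow_left₀ (abs_nonneg _) h3 2
    rw [sq_abs] at h5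
    -- This is `(2 + 2 B)² ≤ 8 + 8 B²`.
    nlinarith [sq_nonneg (B - 1)]
  refine h2.trans ?_
  rw [integral_add (integrable_const _) (hi.const_mul _), integral_const_mul, integral_const,
    probReal_univ, one_smul]
  linarith

end Permutations

theorem mainTheorem3 (k : ℕ) (hk : 1 ≤ k) :
    TendstoInDistribution
      (fun (n : ℕ) (σ : Equiv.Perm (Fin n)) =>
        (asRV n k σ - ∫ τ, asRV n k τ ∂(uniformPerm n)) / Real.sqrt (Var[asRV n k; uniformPerm n]))
      atTop (id : ℝ → ℝ) uniformPerm (gaussianReal 0 1) where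
  forall_aemeasurable _ := Measurable.of_discrete.aemeasurable
  aemeasurable_limit := aemeasurable_id
  tendsto := by
    refine ProbabilityMeasure.tendsto_iff_tendsto_charFun.2 fun t => ?_
    have h := tendsto_charFun_standardize (μ := uniformPerm) (A := fun n => asRV n k)
      (T := centredExtrema) (c := fun n => 2 / 3 * ((n : ℝ) - 2)) (v := 8 / 45)
      (by norm_num) (fun n => .of_discrete) (fun n => .of_discrete) integral_centredExtrema
      tendsto_integral_centredExtrema_sq_div
      ((eventually_ge_atTop 4).mono fun n hn => integral_asRV_sub_centredExtrema_sq_le hk hn)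
      tendsto_charFun_centredExtrema t
    simp only [ProbabilityMeasure.coe_mk, Measure.map_id, charFun_gaussianReal]
    simpa using h
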